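/- Fix a point $\infty \in S^3$ and let $u\colon S^3 \to S^3$ be a smooth involution with $u(\infty)=\infty$ that has a fixed point in $\mathbb{R}^3 = S^3\setminus\{\infty\}$ and whose differential at every fixed point in $\mathbb{R}^3$ is diagonalizable as $[1]\oplus[-1]\oplus[-1]$. Orient $S^3$ in the standard way. A ($u$-)invariant contact structure on $S^3$ is a plane field $\xi = \ker\alpha$, where $\alpha$ is a global smooth $1$-form on $S^3$ with $\alpha\wedge d\alpha > 0$, such that $u^*\xi=\xi$ and $u^*\alpha=-\alpha$. Let $\xi_t$, $t\in[0,1]$, be a smooth family of invariant contact structures on $S^3$ (i.e. locally on $[0,1]\times S^3$ the planes $\xi_t(x)$ are the kernels of $1$-forms on $S^3$ depending smoothly on $(t,x)$). Then there exists a smooth isotopy $\psi_t$, $t\in[0,1]$, of $S^3$, starting at $\psi_0=\mathrm{id}$, which is equivariant, i.e. $\psi_t\circ u = u\circ\psi_t$ for all $t\in[0,1]$, and such that $T\psi_t(\xi_0)=\xi_t$ for all $t\in[0,1]$. -/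

import Mathlib

open scoped Manifold ContDiff

noncomputable section

namespace InvContact

/-- The unit sphere `S³ ⊆ ℝ⁴`, with Mathlib's structure of a smooth `3`-manifold. -/
abbrev S3 : Type := Metric.sphere (0 : EuclideanSpace ℝ (Fin 4)) 1

/-- The tangent space `T_x S³`. -/
abbrev TS (x : S3) : Type := TangentSpace (𝓡 3) x

/-- The differential at `x` of the inclusion `S³ → ℝ⁴`. -/
def dIncl (x : S3) : TS x →L[ℝ] EuclideanSpace ℝ (Fin 4) :=
  mvfderiv (𝓡 3) (fun y : S3 => (y : EuclideanSpace ℝ (Fin 4))) x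

/-- `(v₁, v₂, v₃)` is a positive basis of `T_x S³` for the standard orientation of `S³`, as the
boundary of the unit ball of `ℝ⁴` (outward normal first). -/
def PosOriented (x : S3) (v₁ v₂ v₃ : TS x) : Prop :=
  0 < Matrix.det (Matrix.of
    (fun i j : Fin 4 => ![(x : EuclideanSpace ℝ (Fin 4)), dIncl x v₁, dIncl x v₂, dIncl x v₃] i j))

/-- A (not necessarily smooth) `1`-form on `S³`. -/
abbrev OneForm : Type := (x : S3) → TS x →L[ℝ] ℝ

/-- A (not necessarily smooth) field of linear subspaces of the tangent spaces of `S³`. -/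
abbrev Distribution : Type := (x : S3) → Submodule ℝ (TS x)

/-- A `1`-form is smooth if it is smooth as a function on the total space `T S³`. -/
def OneForm.Smooth (α : OneForm) : Prop :=
  ContMDiff (𝓡 3).tangent 𝓘(ℝ, ℝ) ∞ (fun p : TangentBundle (𝓡 3) S3 => α p.1 p.2)

/-- The distribution `Ker α`. -/
def OneForm.kernel (α : OneForm) : Distribution := fun x => LinearMap.ker (α x).toLinearMap

/-- The expression of `α` in the chart `φ` of `S³` around `x`, that is the `1`-form
`(φ⁻¹)^* α` on (the target of `φ` in) `ℝ³`. -/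
def OneForm.inChart (α : OneForm) (x : S3) (y : EuclideanSpace ℝ (Fin 3)) :
    EuclideanSpace ℝ (Fin 3) →L[ℝ] ℝ :=
  (α ((extChartAt (𝓡 3) x).symm y)).comp
    (mfderiv 𝓘(ℝ, EuclideanSpace ℝ (Fin 3)) (𝓡 3) (extChartAt (𝓡 3) x).symm y)

/-- The exterior derivative `dα` at `x`, computed in the chart `φ` around `x`: if `a = (φ⁻¹)^* α`
then `da (v, w) = (D_v a) w - (D_w a) v`, and `dα = φ^* da`. -/
def OneForm.d (α : OneForm) (x : S3) (v w : TS x) : ℝ :=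
  let φ := extChartAt (𝓡 3) x
  let dφ : TS x →L[ℝ] EuclideanSpace ℝ (Fin 3) :=
    mvfderiv (𝓡 3) φ x
  fderiv ℝ (α.inChart x) (φ x) (dφ v) (dφ w) - fderiv ℝ (α.inChart x) (φ x) (dφ w) (dφ v)

/-- The `3`-form `α ∧ dα`. -/
def OneForm.wedgeD (α : OneForm) (x : S3) (v₁ v₂ v₃ : TS x) : ℝ :=
  α x v₁ * α.d x v₂ v₃ + α x v₂ * α.d x v₃ v₁ + α x v₃ * α.d x v₁ v₂

/-- A positive contact form on `S³`: a smooth `1`-form with `α ∧ dα > 0`. -/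
structure OneForm.IsContact (α : OneForm) : Prop where
  smooth : α.Smooth
  pos : ∀ (x : S3) (v₁ v₂ v₃ : TS x), PosOriented x v₁ v₂ v₃ → 0 < α.wedgeD x v₁ v₂ v₃

/-- The involutions under consideration: smooth involutions of `S³ = ℝ³ ∪ {∞}` fixing `∞`, with a
fixed point in `ℝ³`, and whose differential at every fixed point in `ℝ³` is diagonalizable as
`[1] ⊕ [-1] ⊕ [-1]`. (The tangent spaces at `u p` and `p = u p` are compared inside `ℝ⁴`.) -/
structure IsAdmissibleInvolution (infty : S3) (u : S3 → S3) : Prop where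
  smooth : ContMDiff (𝓡 3) (𝓡 3) ∞ u
  involutive : Function.Involutive u
  fix_infty : u infty = infty
  exists_fixed : ∃ p : S3, p ≠ infty ∧ u p = p
  diagonalizable : ∀ p : S3, p ≠ infty → u p = p →
    ∃ b : Module.Basis (Fin 3) ℝ (TS p), ∀ i : Fin 3,
      dIncl (u p) (mfderiv (𝓡 3) (𝓡 3) u p (b i)) = (![1, -1, -1] i : ℝ) • dIncl p (b i)

/-- `ξ` is a (positively cooriented) `u`-invariant contact structure: `ξ = Ker α` for a positive
contact form `α` on `S³` with `u^* ξ = ξ` and `u^* α = -α`. -/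
def IsInvariantContactStructure (u : S3 → S3) (ξ : Distribution) : Prop :=
  ∃ α : OneForm, α.IsContact ∧ ξ = α.kernel ∧
    (∀ x : S3, (ξ (u x)).comap (mfderiv (𝓡 3) (𝓡 3) u x).toLinearMap = ξ x) ∧
    (∀ (x : S3) (v : TS x), α (u x) (mfderiv (𝓡 3) (𝓡 3) u x v) = -α x v)

/-- The plane fields `ξ t`, `t ∈ [0,1]`, form a smooth family: near every `(t₀, x₀)` they are the
kernels of `1`-forms depending smoothly on `(t, x)`. Smoothness on `[0,1] × S³` at the end points
`t = 0, 1` means, as usual, smoothness of a local extension. -/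
def IsSmoothFamily (ξ : ℝ → Distribution) : Prop :=
  ∀ t₀ ∈ Set.Icc (0 : ℝ) 1, ∀ x₀ : S3,
    ∃ U : Set (ℝ × S3), IsOpen U ∧ (t₀, x₀) ∈ U ∧
    ∃ β : ℝ → OneForm,
      ContMDiffOn (𝓘(ℝ, ℝ).prod (𝓡 3).tangent) 𝓘(ℝ, ℝ) ∞
        (fun p : ℝ × TangentBundle (𝓡 3) S3 => β p.1 p.2.1 p.2.2) {p | (p.1, p.2.1) ∈ U} ∧
      ∀ t ∈ Set.Icc (0 : ℝ) 1, ∀ x : S3, (t, x) ∈ U → ξ t x = (β t).kernel x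

/-- `ψ t`, `t ∈ [0,1]`, is a smooth isotopy of `S³`, starting at the identity, and commuting
with `u`. As above, smoothness on `[0,1] × S³` is smoothness on a neighbourhood of it. -/
structure IsEquivariantIsotopy (u : S3 → S3) (ψ : ℝ → S3 → S3) : Prop where
  smooth : ∃ O : Set ℝ, IsOpen O ∧ Set.Icc (0 : ℝ) 1 ⊆ O ∧
    ContMDiffOn (𝓘(ℝ, ℝ).prod (𝓡 3)) (𝓡 3) ∞ (fun p : ℝ × S3 => ψ p.1 p.2) (O ×ˢ Set.univ)
  diffeo : ∀ t ∈ Set.Icc (0 : ℝ) 1, ∃ Ψ : S3 ≃ₘ^∞⟮𝓡 3, 𝓡 3⟯ S3, ⇑Ψ = ψ t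
  start : ψ 0 = id
  equivariant : ∀ t ∈ Set.Icc (0 : ℝ) 1, ψ t ∘ u = u ∘ ψ t

end InvContact

end

/-!
Gray's theorem by Moser's method, in a form that respects all symmetries. The plane fields `ξ t`
are pulled back by the radial projection to hyperplane fields `D t` on `ℝ⁴ \ 0`, locally defined
by smooth forms `B`. At each point there is exactly one vector `X ∈ D t` tangent to the sphere
such that `(∂ₜ + ℒ_X) B` vanishes on `D t`, for one or equivalently for all `B`. Uniqueness is the
contact condition; existence and smooth dependence on the point come from a square linear system
with Lagrange multipliers for the two constraints on `X`. A partition of unity extends these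
vectors to a compactly supported field, because it averages equal vectors wherever the condition
is imposed.

Along the evolution of this field, `B` evaluated on a transported vector satisfies a linear
differential equation `g' = μ g`, hence vanishes at all times or at none, and the hyperplanes are
preserved. Since the field is characterized by the hyperplanes alone, a symmetry of the `ξ t` maps
it to itself and commutes with its evolution.
-/

open Set Filter
open scoped Topology RealInnerProductSpace

universe u

/-! ### Smooth dependence of flows on time and initial conditions -/

namespace SmoothFlow

section Nemytskii

variable (K : Type*) [TopologicalSpace K] [CompactSpace K]

/-- Pointwise application `C(K, E →L F) → C(K, E) → C(K, F)`, as a bounded bilinear map. -/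
noncomputable def applyL (E F : Type*) [NormedAddCommGroup E] [NormedSpace ℝ E]
    [NormedAddCommGroup F] [NormedSpace ℝ F] :
    C(K, E →L[ℝ] F) →L[ℝ] C(K, E) →L[ℝ] C(K, F) :=
  LinearMap.mkContinuous₂
    (LinearMap.mk₂ ℝ (fun (A : C(K, E →L[ℝ] F)) (h : C(K, E)) =>
        (⟨fun s => A s (h s), A.continuous.clm_apply h.continuous⟩ : C(K, F)))
      (fun _ _ _ => by ext; simp) (fun _ _ _ => by ext; simp)
      (fun _ _ _ => by ext; simp) (fun _ _ _ => by ext; simp)) 1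
    (fun A h => by
      rw [one_mul]
      refine (ContinuousMap.norm_le _ (by positivity)).2 fun s => ?_
      exact ((A s).le_opNorm _).trans (mul_le_mul (A.norm_coe_le_norm s) (h.norm_coe_le_norm s)
        (norm_nonneg _) (norm_nonneg A)))

variable {K}

lemma hasFDerivAt_continuousMap_comp {E F : Type*} [NormedAddCommGroup E] [NormedSpace ℝ E]
    [NormedAddCommGroup F] [NormedSpace ℝ F] {f : C(E, F)} {f' : C(E, E →L[ℝ] F)}
    (hf : ∀ x, HasFDerivAt f (f' x) x) (γ : C(K, E)) :
    HasFDerivAt (fun γ : C(K, E) => f.comp γ) (applyL K E F (f'.comp γ)) γ := by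
  rw [hasFDerivAt_iff_isLittleO_nhds_zero, Asymptotics.isLittleO_iff]
  intro ε hε
  obtain ⟨δ, hδ, hf'δ⟩ := Metric.continuous_iff (α := C(K, E)) (β := C(K, E →L[ℝ] F))
    |>.1 f'.continuous_postcomp γ ε hε
  filter_upwards [Metric.ball_mem_nhds (0 : C(K, E)) hδ] with h hh
  rw [mem_ball_zero_iff] at hh
  refine (ContinuousMap.norm_le _ (by positivity)).2 fun s => ?_
  -- The uniform modulus of continuity of `γ ↦ f' ∘ γ` is tested on translates of `γ`.
  have norm_sub_le : ∀ z ∈ Metric.ball (γ s) δ, ‖f' z - f' (γ s)‖ ≤ ε := by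
    intro z hz
    have dist_translate : dist (γ + ContinuousMap.const K (z - γ s)) γ < δ := by
      rw [dist_eq_norm, add_sub_cancel_left]
      refine (ContinuousMap.norm_lt_iff _ hδ).2 fun _ => ?_
      simpa [dist_eq_norm] using hz
    simpa [dist_eq_norm] using (ContinuousMap.dist_le hε.le).1 (hf'δ _ dist_translate).le s
  have hmem : γ s + h s ∈ Metric.ball (γ s) δ := by
    rw [Metric.mem_ball, dist_eq_norm, add_sub_cancel_left]
    exact (h.norm_coe_le_norm s).trans_lt hh
  have := (convex_ball (γ s) δ).norm_image_sub_le_of_norm_hasFDerivWithin_le'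
    (fun z _ => (hf z).hasFDerivWithinAt) norm_sub_le (Metric.mem_ball_self hδ) hmem
  rw [add_sub_cancel_left] at this
  exact this.trans (mul_le_mul_of_nonneg_left (h.norm_coe_le_norm s) hε.le)

lemma contDiff_nat_continuousMap_comp {E : Type u} [NormedAddCommGroup E] [NormedSpace ℝ E]
    (n : ℕ) {F : Type u} [NormedAddCommGroup F] [NormedSpace ℝ F] {f : C(E, F)}
    (hf : ContDiff ℝ n f) : ContDiff ℝ n (fun γ : C(K, E) => f.comp γ) := by
  induction n generalizing F with
  | zero => exact contDiff_zero.2 (ContinuousMap.continuous_postcomp _)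
  | succ n ih =>
    have hfderiv : ContDiff ℝ n (fderiv ℝ f) := hf.fderiv_right (by norm_cast)
    let f' : C(E, E →L[ℝ] F) := ⟨fderiv ℝ f, hfderiv.continuous⟩
    have hf' : ∀ x, HasFDerivAt f (f' x) x := fun x =>
      (hf.differentiable (by norm_cast) x).hasFDerivAt
    exact contDiff_succ_iff_hasFDerivAt.2
      ⟨_, (applyL K E F).contDiff.comp (ih (f := f') hfderiv), hasFDerivAt_continuousMap_comp hf'⟩

lemma contDiff_continuousMap_comp {E F : Type u} [NormedAddCommGroup E] [NormedSpace ℝ E]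
    [NormedAddCommGroup F] [NormedSpace ℝ F] {n : ℕ∞} {f : C(E, F)} (hf : ContDiff ℝ n f) :
    ContDiff ℝ n (fun γ : C(K, E) => f.comp γ) :=
  contDiff_iff_forall_nat_le.2 fun m hm =>
    contDiff_nat_continuousMap_comp m (hf.of_le (by exact_mod_cast hm))

end Nemytskii

variable {E : Type u} [NormedAddCommGroup E] [NormedSpace ℝ E]

/-- The Volterra operator `γ ↦ (s ↦ ∫₀ˢ γ)` on `C([0,1], E)`. -/
noncomputable def volterra : C(unitInterval, E) →L[ℝ] C(unitInterval, E) :=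
  LinearMap.mkContinuous
    { toFun := fun γ => ⟨fun s => ∫ τ in (0 : ℝ)..s, IccExtend zero_le_one γ τ,
        (intervalIntegral.continuous_primitive
          (fun _ _ => (γ.continuous.Icc_extend').intervalIntegrable _ _) 0).comp
          continuous_subtype_val⟩
      map_add' := fun γ η => by
        ext s
        exact intervalIntegral.integral_add
          ((γ.continuous.Icc_extend' (h := zero_le_one)).intervalIntegrable _ _)
          ((η.continuous.Icc_extend' (h := zero_le_one)).intervalIntegrable _ _)
      map_smul' := fun c γ => by
        ext s
        exact intervalIntegral.integral_smul c (IccExtend zero_le_one γ) } 1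
    (fun γ => by
      rw [one_mul]
      refine (ContinuousMap.norm_le _ (norm_nonneg _)).2 fun s => ?_
      refine (intervalIntegral.norm_integral_le_of_norm_le_const
        (fun τ _ => γ.norm_coe_le_norm (projIcc 0 1 zero_le_one τ))).trans ?_
      rw [sub_zero, abs_of_nonneg s.2.1]
      exact mul_le_of_le_one_right (norm_nonneg _) s.2.2)

lemma volterra_apply_of_eqOn {γ : C(unitInterval, E)} {g : ℝ → E}
    (hg : ∀ s : unitInterval, γ s = g s) (s : unitInterval) :
    volterra γ s = ∫ τ in (0 : ℝ)..s, g τ := by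
  refine intervalIntegral.integral_congr fun τ hτ => ?_
  rw [uIcc_of_le s.2.1] at hτ
  have hτI : τ ∈ Icc (0 : ℝ) 1 := ⟨hτ.1, hτ.2.trans s.2.2⟩
  exact (IccExtend_of_mem zero_le_one γ hτI).trans (hg ⟨τ, hτI⟩)

/-- The defect of a path `γ : [0,1] → E` as a solution of `γ' = t f(γ)`, `γ 0 = x`. The factor `t`
rescales the orbit of `x` up to time `t` to the fixed interval `[0,1]`. -/
noncomputable def picardDefect (f : C(E, E)) (p : (ℝ × E) × C(unitInterval, E)) :
    C(unitInterval, E) :=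
  p.2 - ContinuousLinearMap.const ℝ unitInterval p.1.2 - p.1.1 • volterra (f.comp p.2)

lemma contDiff_picardDefect {n : ℕ∞} {f : C(E, E)} (hf : ContDiff ℝ n f) :
    ContDiff ℝ n (picardDefect f) := by
  have hcomp : ContDiff ℝ n fun p : (ℝ × E) × C(unitInterval, E) => f.comp p.2 :=
    (contDiff_continuousMap_comp hf).comp contDiff_snd
  have hconst : ContDiff ℝ n fun p : (ℝ × E) × C(unitInterval, E) =>
      ContinuousLinearMap.const ℝ unitInterval p.1.2 :=
    (contDiff_snd.comp contDiff_fst).continuousLinearMap_comp _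
  have hvolterra : ContDiff ℝ n fun p : (ℝ × E) × C(unitInterval, E) => volterra (f.comp p.2) :=
    hcomp.continuousLinearMap_comp volterra
  exact (contDiff_snd.sub hconst).sub ((contDiff_fst.comp contDiff_fst).smul hvolterra)

lemma fderiv_picardDefect_comp_inr {f : C(E, E)} {x : E} {γ : C(unitInterval, E)}
    (hf : DifferentiableAt ℝ (picardDefect f) ((0, x), γ)) :
    fderiv ℝ (picardDefect f) ((0, x), γ) ∘L .inr ℝ (ℝ × E) C(unitInterval, E) = .id ℝ _ := by
  have slice : (fun η => picardDefect f ((0, x), η)) =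
      fun η => η - ContinuousLinearMap.const ℝ unitInterval x := by
    funext η; simp [picardDefect]
  have hslice : HasFDerivAt (fun η => picardDefect f ((0, x), η))
      (fderiv ℝ (picardDefect f) ((0, x), γ) ∘L .inr ℝ (ℝ × E) C(unitInterval, E)) γ :=
    hf.hasFDerivAt.comp γ (hasFDerivAt_prodMk_right (0, x) γ)
  refine hslice.unique ?_
  rw [slice]
  exact (hasFDerivAt_id _).sub_const _

/-- `φ` is a complete flow of the vector field `f`. The group law is a consequence
(`IsFlow.map_add`) when `f` is Lipschitz. -/
structure IsFlow (f : E → E) (φ : ℝ → E → E) : Prop where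
  map_zero : ∀ x, φ 0 x = x
  hasDerivAt : ∀ x t, HasDerivAt (φ · x) (f (φ t x)) t

namespace IsFlow

variable {f : E → E} {φ : ℝ → E → E}

lemma continuous (h : IsFlow f φ) (x : E) : Continuous (φ · x) :=
  continuous_iff_continuousAt.2 fun t => (h.hasDerivAt x t).continuousAt

lemma norm_sub_le (h : IsFlow f φ) {L : ℝ} (hL : ∀ x, ‖f x‖ ≤ L) (t : ℝ) (x : E) :
    ‖φ t x - x‖ ≤ L * |t| := by
  simpa [h.map_zero] using convex_univ.norm_image_sub_le_of_norm_hasDerivWithin_le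
    (fun s _ => (h.hasDerivAt x s).hasDerivWithinAt) (fun s _ => hL (φ s x))
    (mem_univ 0) (mem_univ t)

lemma map_add (h : IsFlow f φ) {K : NNReal} (hK : LipschitzWith K f) (s t : ℝ) (x : E) :
    φ (s + t) x = φ s (φ t x) := by
  have translate : ∀ s, HasDerivAt (fun s => φ (s + t) x) (f (φ (s + t) x)) s := fun s =>
    (h.hasDerivAt x (s + t)).comp_add_const s t
  exact congrFun (ODE_solution_unique_univ (v := fun _ => f) (s := fun _ => univ) (t₀ := 0)
    (fun _ => hK.lipschitzOnWith) (fun s => ⟨translate s, mem_univ _⟩)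
    (fun s => ⟨h.hasDerivAt (φ t x) s, mem_univ _⟩) (by simp [h.map_zero])) s

/-- The orbit of `x` up to time `t`, rescaled to `[0,1]`, for `p = (t, x)`. -/
def orbit (h : IsFlow f φ) (p : ℝ × E) : C(unitInterval, E) :=
  ⟨fun s => φ (p.1 * s) p.2,
    (h.continuous p.2).comp (continuous_const.mul continuous_subtype_val)⟩

lemma orbit_zero (h : IsFlow f φ) (x : E) :
    h.orbit (0, x) = ContinuousLinearMap.const ℝ unitInterval x := by
  ext s; simp [orbit, h.map_zero]

lemma picardDefect_orbit [CompleteSpace E] (h : IsFlow f φ) (hf : Continuous f) (p : ℝ × E) :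
    picardDefect ⟨f, hf⟩ (p, h.orbit p) = 0 := by
  ext s
  have hderiv : ∀ τ : ℝ, HasDerivAt (fun τ => φ (p.1 * τ) p.2) (p.1 • f (φ (p.1 * τ) p.2)) τ := by
    intro τ
    simpa using! (h.hasDerivAt p.2 (p.1 * τ)).scomp τ ((hasDerivAt_id τ).const_mul p.1)
  have hcont : Continuous fun τ => p.1 • f (φ (p.1 * τ) p.2) :=
    (hf.comp ((h.continuous p.2).comp (continuous_const_mul p.1))).const_smul p.1
  have integral_eq := intervalIntegral.integral_eq_sub_of_hasDerivAt (a := 0) (b := (s : ℝ))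
    (fun τ _ => hderiv τ) (hcont.intervalIntegrable _ _)
  rw [intervalIntegral.integral_smul, mul_zero, h.map_zero] at integral_eq
  change φ (p.1 * s) p.2 - p.2 - p.1 • volterra _ s = 0
  rw [volterra_apply_of_eqOn (g := fun τ => f (φ (p.1 * τ) p.2)) (fun _ => rfl), integral_eq,
    sub_self]

lemma continuousAt_orbit (h : IsFlow f φ) {L : ℝ} (hL : ∀ x, ‖f x‖ ≤ L) (x₀ : E) :
    ContinuousAt h.orbit (0, x₀) := by
  rw [ContinuousAt, orbit_zero, tendsto_iff_norm_sub_tendsto_zero]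
  have norm_le (p : ℝ × E) :
      ‖h.orbit p - ContinuousLinearMap.const ℝ unitInterval x₀‖ ≤ L * |p.1| + ‖p.2 - x₀‖ := by
    have hL₀ : 0 ≤ L := (norm_nonneg _).trans (hL 0)
    refine (ContinuousMap.norm_le _ (by positivity)).2 fun s => ?_
    have abs_le : |p.1 * s| ≤ |p.1| := by
      rw [abs_mul, abs_of_nonneg s.2.1]
      exact mul_le_of_le_one_right (abs_nonneg _) s.2.2
    calc ‖φ (p.1 * s) p.2 - x₀‖ ≤ ‖φ (p.1 * s) p.2 - p.2‖ + ‖p.2 - x₀‖ :=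
          norm_sub_le_norm_sub_add_norm_sub ..
      _ ≤ L * |p.1 * s| + ‖p.2 - x₀‖ := by gcongr; exact h.norm_sub_le hL _ _
      _ ≤ L * |p.1| + ‖p.2 - x₀‖ := by gcongr
  refine squeeze_zero (fun _ => norm_nonneg _) norm_le ?_
  have : Continuous fun p : ℝ × E => L * |p.1| + ‖p.2 - x₀‖ := by fun_prop
  simpa using this.tendsto (0, x₀)

/-- The implicit function theorem for `picardDefect`. -/
lemma contDiffAt_zero [CompleteSpace E] (h : IsFlow f φ) {n : ℕ∞} (hn : n ≠ 0)
    (hf : ContDiff ℝ n f) {L : ℝ} (hL : ∀ x, ‖f x‖ ≤ L) (x₀ : E) :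
    ContDiffAt ℝ n (fun p : ℝ × E => φ p.1 p.2) (0, x₀) := by
  let G := picardDefect ⟨f, hf.continuous⟩
  let w : (ℝ × E) × C(unitInterval, E) := ((0, x₀), h.orbit (0, x₀))
  have hn' : (n : ℕ∞ω) ≠ 0 := by exact_mod_cast hn
  have hG : ContDiffAt ℝ n G w := (contDiff_picardDefect (f := ⟨f, hf.continuous⟩) hf).contDiffAt
  have hinv : (fderiv ℝ G w ∘L .inr ℝ (ℝ × E) C(unitInterval, E)).IsInvertible := by
    rw [fderiv_picardDefect_comp_inr (hG.differentiableAt hn')]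
    exact ⟨.refl ℝ _, rfl⟩
  have orbit_eq : ∀ᶠ p in 𝓝 (0, x₀), hG.implicitFunction hn' hinv p = h.orbit p := by
    have hpair : Tendsto (fun p => (p, h.orbit p)) (𝓝 (0, x₀)) (𝓝 w) :=
      continuousAt_id.prodMk (h.continuousAt_orbit hL x₀)
    filter_upwards [hpair.eventually (hG.eventually_apply_eq_iff_implicitFunction hn' hinv)]
      with p hp
    exact hp.1 (by simp only [G, w, picardDefect_orbit])
  refine (((ContinuousMap.evalCLM ℝ (1 : unitInterval)).contDiff.contDiffAt.comp _
    (hG.contDiffAt_implicitFunction hn' hinv)).congr_of_eventuallyEq ?_)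
  filter_upwards [orbit_eq] with p hp
  simp [hp, orbit]

lemma contDiffAt_of_contDiffAt (h : IsFlow f φ) {K : NNReal} (hK : LipschitzWith K f)
    {n : ℕ∞ω} {a b : ℝ} {x₀ : E} (ha : ContDiffAt ℝ n (fun p : ℝ × E => φ p.1 p.2) (a, x₀))
    (hb : ContDiffAt ℝ n (fun p : ℝ × E => φ p.1 p.2) (b - a, φ a x₀)) :
    ContDiffAt ℝ n (fun p : ℝ × E => φ p.1 p.2) (b, x₀) := by
  have hφa : ContDiffAt ℝ n (fun p : ℝ × E => φ a p.2) (b, x₀) :=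
    ContDiffAt.comp (g := fun p : ℝ × E => φ p.1 p.2) (f := fun p : ℝ × E => (a, p.2))
      (b, x₀) ha (by fun_prop)
  have hpair : ContDiffAt ℝ n (fun p : ℝ × E => (p.1 - a, φ a p.2)) (b, x₀) :=
    ContDiffAt.prodMk (by fun_prop) hφa
  have hcomp := ContDiffAt.comp (g := fun p : ℝ × E => φ p.1 p.2)
    (f := fun p : ℝ × E => (p.1 - a, φ a p.2)) (b, x₀) hb hpair
  refine hcomp.congr_of_eventuallyEq (.of_forall fun p => ?_)
  simp only [Function.comp_apply, ← h.map_add hK, sub_add_cancel]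

/-- Regularity at time `0` propagates along the orbit of `x₀` by the group law: both the set of
times where the flow is `C^n` and its complement are open. -/
lemma contDiff [CompleteSpace E] (h : IsFlow f φ) {n : ℕ∞} (hn : n ≠ 0) (hf : ContDiff ℝ n f)
    {K : NNReal} (hK : LipschitzWith K f) {L : ℝ} (hL : ∀ x, ‖f x‖ ≤ L) :
    ContDiff ℝ n (fun p : ℝ × E => φ p.1 p.2) := by
  refine contDiff_iff_forall_nat_le.2 fun m hm => contDiff_iff_contDiffAt.2 ?_
  rintro ⟨t₁, x₀⟩
  have at_zero (y : E) : ContDiffAt ℝ m (fun p : ℝ × E => φ p.1 p.2) (0, y) :=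
    (h.contDiffAt_zero hn hf hL y).of_le (by exact_mod_cast hm)
  have hconst : IsLocallyConstant fun t =>
      ContDiffAt ℝ m (fun p : ℝ × E => φ p.1 p.2) (t, x₀) := by
    rw [IsLocallyConstant.iff_eventually_eq]
    intro t
    have near_zero := (at_zero (φ t x₀)).eventually (by simp)
    have hφ := h.continuous x₀
    have forward : ContinuousAt (fun s : ℝ => (s - t, φ t x₀)) t := by fun_prop
    have backward : ContinuousAt (fun s : ℝ => (t - s, φ s x₀)) t := by fun_prop
    filter_upwards [forward.eventually (by simpa using near_zero),
      backward.eventually (by simpa using near_zero)] with s hs hs'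
    exact propext ⟨fun hP => h.contDiffAt_of_contDiffAt hK hP hs',
      fun hP => h.contDiffAt_of_contDiffAt hK hP hs⟩
  exact (hconst.apply_eq_of_preconnectedSpace 0 t₁).mp (at_zero x₀)

end IsFlow

lemma exists_isFlow [CompleteSpace E] {f : E → E} (hf : ContDiff ℝ 1 f) {K L : NNReal}
    (hK : LipschitzWith K f) (hL : ∀ x, ‖f x‖ ≤ L) : ∃ φ : ℝ → E → E, IsFlow f φ := by
  have picard (y : E) : IsPicardLindelof (fun _ => f) (tmin := -1) (tmax := 1) ⟨0, by simp⟩ y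
      L 0 L K :=
    { lipschitzOnWith := fun _ _ => hK.lipschitzOnWith
      continuousOn := fun _ _ => continuousOn_const
      norm_le := fun _ _ z _ => hL z
      mul_max_le := by simp }
  have hmdiff : ContMDiff 𝓘(ℝ, E) 𝓘(ℝ, E).tangent 1
      (fun x : E => (⟨x, f x⟩ : TangentBundle 𝓘(ℝ, E) E)) :=
    contMDiff_vectorSpace_iff_contDiff.2 hf
  have global (x : E) : ∃ γ : ℝ → E, γ 0 = x ∧ IsMIntegralCurve (I := 𝓘(ℝ, E)) γ f := by
    refine exists_isMIntegralCurve_of_isMIntegralCurveOn hmdiff one_pos (fun y => ?_) x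
    obtain ⟨α, hα₀, hα⟩ := (picard y).exists_eq_forall_mem_Icc_hasDerivWithinAt₀
    exact ⟨α, hα₀, fun t ht => ((hα t (Ioo_subset_Icc_self ht)).mono
      Ioo_subset_Icc_self).hasFDerivWithinAt.hasMFDerivWithinAt⟩
  choose γ hγ₀ hγ using global
  refine ⟨fun t x => γ x t, hγ₀, fun x t => ?_⟩
  have : HasFDerivAt (γ x) ((1 : ℝ →L[ℝ] ℝ).smulRight (f (γ x t))) t := (hγ x t).hasFDerivAt
  simpa using this.hasDerivAt

end SmoothFlow

/-! ### Evolutions of time-dependent vector fields -/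

namespace SmoothFlow

variable {E : Type u} [NormedAddCommGroup E] [NormedSpace ℝ E]

/-- `Ψ` is the evolution of the time-dependent vector field `Y`, started at time `0`: each curve
`t ↦ Ψ t x` solves `c' = Y (t, c)`. -/
structure IsEvolution (Y : ℝ × E → E) (Ψ : ℝ → E → E) : Prop where
  map_zero : ∀ x, Ψ 0 x = x
  hasDerivAt : ∀ x t, HasDerivAt (Ψ · x) (Y (t, Ψ t x)) t

lemma IsFlow.fst_eq_add {Y : ℝ × E → E} {φ : ℝ → ℝ × E → ℝ × E}
    (h : IsFlow (fun q => ((1 : ℝ), Y q)) φ) (t : ℝ) (q : ℝ × E) : (φ t q).1 = q.1 + t := by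
  have deriv_sub (s : ℝ) : HasDerivAt (fun s => (φ s q).1 - s) 0 s := by
    simpa using! ((hasFDerivAt_fst (𝕜 := ℝ) (p := φ s q)).comp_hasDerivAt s
      (h.hasDerivAt q s)).sub (hasDerivAt_id s)
  have := is_const_of_deriv_eq_zero (fun s => (deriv_sub s).differentiableAt)
    (fun s => (deriv_sub s).deriv) t 0
  simp only [h.map_zero, sub_zero] at this
  linarith

theorem exists_isEvolution [CompleteSpace E] {Y : ℝ × E → E} {n : ℕ∞} (hn : n ≠ 0)
    (hY : ContDiff ℝ n Y) {K : NNReal} (hK : LipschitzWith K Y) {C : ℝ} (hC : ∀ q, ‖Y q‖ ≤ C) :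
    ∃ Ψ : ℝ → E → E, IsEvolution Y Ψ ∧ ContDiff ℝ n (fun q : ℝ × E => Ψ q.1 q.2) ∧
      ∀ t, ∃ Φ : E ≃ₘ^n⟮𝓘(ℝ, E), 𝓘(ℝ, E)⟯ E, ⇑Φ = Ψ t := by
  -- The suspension `q ↦ (1, Y q)` turns `Y` into an autonomous vector field on `ℝ × E`.
  have hsusp : ContDiff ℝ n (fun q => ((1 : ℝ), Y q)) := contDiff_const.prodMk hY
  have hsuspK : LipschitzWith (max 0 K) (fun q => ((1 : ℝ), Y q)) :=
    (LipschitzWith.const (1 : ℝ)).prodMk hK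
  have hsuspC (q : ℝ × E) : ‖((1 : ℝ), Y q)‖ ≤ (max 1 C).toNNReal := by
    rw [Real.coe_toNNReal _ (le_max_of_le_left zero_le_one), Prod.norm_def, norm_one]
    exact max_le_max le_rfl (hC q)
  obtain ⟨φ, hφ⟩ := exists_isFlow
    (hsusp.of_le (by exact_mod_cast Order.one_le_iff_ne_zero.2 hn)) hsuspK hsuspC
  have hsmooth := hφ.contDiff hn hsusp hsuspK hsuspC
  have eta (t : ℝ) (x : E) : (t, (φ t (0, x)).2) = φ t (0, x) :=
    Prod.ext (by simp [hφ.fst_eq_add]) rfl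
  have eta_neg (t : ℝ) (x : E) : (0, (φ (-t) (t, x)).2) = φ (-t) (t, x) :=
    Prod.ext (by simp [hφ.fst_eq_add]) rfl
  have smooth_evolution : ContDiff ℝ n (fun q : ℝ × E => (φ q.1 (0, q.2)).2) :=
    contDiff_snd.comp (hsmooth.comp (contDiff_fst.prodMk (contDiff_const.prodMk contDiff_snd)))
  refine ⟨fun t x => (φ t (0, x)).2, ⟨fun x => by simp only [hφ.map_zero], fun x t => ?_⟩,
    smooth_evolution, fun t => ⟨
      { toFun x := (φ t (0, x)).2
        invFun x := (φ (-t) (t, x)).2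
        left_inv x := ?_
        right_inv x := ?_
        contMDiff_toFun := (smooth_evolution.comp (contDiff_prodMk_right t)).contMDiff
        contMDiff_invFun := (contDiff_snd.comp (hsmooth.comp
          (contDiff_const.prodMk (contDiff_prodMk_right t)))).contMDiff }, rfl⟩⟩
  · rw [eta]
    exact (hasFDerivAt_snd (𝕜 := ℝ) (p := φ t (0, x))).comp_hasDerivAt t (hφ.hasDerivAt (0, x) t)
  · simp only [eta, ← hφ.map_add hsuspK, neg_add_cancel, hφ.map_zero]
  · simp only [eta_neg, ← hφ.map_add hsuspK, add_neg_cancel, hφ.map_zero]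

lemma hasFDerivAt_comp_prodMk {F G : Type*} [NormedAddCommGroup F] [NormedSpace ℝ F]
    [NormedAddCommGroup G] [NormedSpace ℝ G] {f : F × E → G} {f' : F × E →L[ℝ] G} {p : F × E}
    (hf : HasFDerivAt f f' p) : HasFDerivAt (fun z => f (p.1, z)) (f'.comp (.inr ℝ F E)) p.2 :=
  HasFDerivAt.comp p.2 hf (hasFDerivAt_prodMk_right p.1 p.2)

namespace IsEvolution

variable {Y : ℝ × E → E} {Ψ : ℝ → E → E}

lemma fderiv_uncurry_time (h : IsEvolution Y Ψ) {p : ℝ × E}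
    (hd : DifferentiableAt ℝ (fun q : ℝ × E => Ψ q.1 q.2) p) :
    fderiv ℝ (fun q : ℝ × E => Ψ q.1 q.2) p (1, 0) = Y (p.1, Ψ p.1 p.2) :=
  (HasFDerivAt.comp_hasDerivAt (f := fun s => (s, p.2)) p.1 hd.hasFDerivAt
    ((hasDerivAt_id p.1).prodMk (hasDerivAt_const p.1 p.2))).unique (h.hasDerivAt p.2 p.1)

/-- Differentiate `∂ₜΨ = Y (t, Ψ)` in space and exchange the two derivatives. -/
lemma hasDerivAt_fderiv (h : IsEvolution Y Ψ) (hY : Differentiable ℝ Y)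
    (hΨ : ContDiff ℝ 2 (fun q : ℝ × E => Ψ q.1 q.2)) (x v : E) (t : ℝ) :
    HasDerivAt (fun t => fderiv ℝ (Ψ t) x v)
      (fderiv ℝ Y (t, Ψ t x) (0, fderiv ℝ (Ψ t) x v)) t := by
  set F : ℝ × E → E := fun q => Ψ q.1 q.2
  have hF : Differentiable ℝ F := hΨ.differentiable two_ne_zero
  have hF' : Differentiable ℝ (fderiv ℝ F) :=
    (hΨ.fderiv_right (m := 1) (by norm_num)).differentiable one_ne_zero
  have space_fderiv (t : ℝ) : fderiv ℝ (Ψ t) x v = fderiv ℝ F (t, x) (0, v) := by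
    rw [(hasFDerivAt_comp_prodMk (hF (t, x)).hasFDerivAt).fderiv]
    simp
  have time_deriv : HasDerivAt (fun s => fderiv ℝ F (s, x) (0, v))
      (fderiv ℝ (fderiv ℝ F) (t, x) (1, 0) (0, v)) t := by
    simpa using (HasFDerivAt.comp_hasDerivAt (f := fun s => (s, x)) t (hF' (t, x)).hasFDerivAt
      ((hasDerivAt_id t).prodMk (hasDerivAt_const t x))).clm_apply (hasDerivAt_const t (0, v))
  have mixed : fderiv ℝ (fderiv ℝ F) (t, x) (0, v) (1, 0) =
      fderiv ℝ Y (t, Ψ t x) (0, fderiv ℝ F (t, x) (0, v)) := by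
    have lhs := (hF' (t, x)).hasFDerivAt.clm_apply (hasFDerivAt_const ((1 : ℝ), (0 : E)) (t, x))
    have rhs := HasFDerivAt.comp (g := Y) (t, x) (hY (t, F (t, x))).hasFDerivAt
      (hasFDerivAt_fst.prodMk (hF (t, x)).hasFDerivAt)
    have hfun : (fun q => fderiv ℝ F q (1, 0)) = Y ∘ fun q => (q.1, F q) :=
      funext fun q => h.fderiv_uncurry_time (hF q)
    rw [hfun] at lhs
    simpa using congrArg (fun L : ℝ × E →L[ℝ] E => L (0, v)) (lhs.unique rhs)
  have symm : IsSymmSndFDerivAt ℝ F (t, x) :=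
    hΨ.contDiffAt.isSymmSndFDerivAt (by simp)
  simp only [space_fderiv]
  rwa [← mixed, symm.eq]

end IsEvolution

end SmoothFlow

/-! ### Conic contact structures and their Gray vectors -/

namespace ConicGray

section LinearForms

lemma hasFDerivAt_eq_zero {V W : Type*} [NormedAddCommGroup V] [NormedSpace ℝ V]
    [NormedAddCommGroup W] [NormedSpace ℝ W] {F : V → W} {F' : V →L[ℝ] W} {s : Set V} {p : V}
    (hs : UniqueDiffWithinAt ℝ s p) (hp : p ∈ s) (hF : HasFDerivAt F F' p)
    (h0 : ∀ᶠ q in 𝓝[s] p, F q = 0) : F' = 0 :=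
  hs.eq hF.hasFDerivWithinAt
    ((hasFDerivWithinAt_const (0 : W) p s).congr_of_eventuallyEq h0 (h0.self_of_nhdsWithin hp))

variable {V E : Type*} [NormedAddCommGroup V] [NormedSpace ℝ V] [NormedAddCommGroup E]
  [NormedSpace ℝ E]

/-- On the common kernel, the derivatives of two families of forms with the same kernels are
proportional, with the same ratio as the forms themselves. -/
lemma fderiv_apply_mul_comm {B B' : V → E →L[ℝ] ℝ} {s : Set V} {p : V}
    (hs : UniqueDiffWithinAt ℝ s p) (hp : p ∈ s) (hB : DifferentiableAt ℝ B p)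
    (hB' : DifferentiableAt ℝ B' p) (hker : ∀ᶠ q in 𝓝[s] p, ∀ w, B q w = 0 ↔ B' q w = 0)
    {w : E} (hw : B p w = 0) (e : E) (v : V) :
    fderiv ℝ B' p v w * B p e = fderiv ℝ B p v w * B' p e := by
  have hw' : B' p w = 0 := (hker.self_of_nhdsWithin hp w).1 hw
  have minor_eq_zero : ∀ᶠ q in 𝓝[s] p, B' q w * B q e - B q w * B' q e = 0 := by
    filter_upwards [hker] with q hq
    have := (hq (B q e • w - B q w • e)).1 (by simp [mul_comm])
    simp only [map_sub, map_smul, smul_eq_mul] at this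
    linarith
  have apply_deriv {A : V → E →L[ℝ] ℝ} (hA : DifferentiableAt ℝ A p) (a : E) :=
    hA.hasFDerivAt.clm_apply (hasFDerivAt_const a p)
  have minor_deriv := hasFDerivAt_eq_zero hs hp
    (((apply_deriv hB' w).mul (apply_deriv hB e)).sub ((apply_deriv hB w).mul (apply_deriv hB' e)))
    minor_eq_zero
  have := congrArg (fun L : V →L[ℝ] ℝ => L v) minor_deriv
  simp only [hw, hw', ContinuousLinearMap.comp_zero, zero_add, zero_smul, sub_apply, smul_apply,
    ContinuousLinearMap.flip_apply, smul_eq_mul, zero_apply] at this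
  linarith

lemma contDiffAt_clm_apply_iff [FiniteDimensional ℝ E] {F : Type*} [NormedAddCommGroup F]
    [NormedSpace ℝ F] {n : ℕ∞ω} {f : V → E →L[ℝ] F} {q : V} :
    ContDiffAt ℝ n f q ↔ ∀ w, ContDiffAt ℝ n (fun x => f x w) q := by
  refine ⟨fun h w => h.clm_apply contDiffAt_const, fun h => ?_⟩
  let b := Module.finBasis ℝ E
  have hf : f = fun x => ∑ i, ContinuousLinearMap.smulRightL ℝ E F
      (LinearMap.toContinuousLinearMap (b.coord i)) (f x (b i)) := by
    funext x
    ext w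
    have := congrArg (f x) (b.sum_repr w)
    simp only [map_sum, map_smul] at this
    simp [← this]
  rw [hf]
  exact ContDiffAt.sum fun i _ => (ContinuousLinearMap.contDiff _).contDiffAt.comp q (h (b i))

end LinearForms

variable {E : Type u} [NormedAddCommGroup E] [InnerProductSpace ℝ E]

/-- `B` is a family of linear forms, smooth near `p`, that defines the time-dependent distribution
`D` near `p` at the times in `[0,1]`. -/
structure IsDefiningForm (D : ℝ × E → Submodule ℝ E) (p : ℝ × E) (B : ℝ × E → E →L[ℝ] ℝ) :
    Prop where
  smooth : ∀ᶠ q in 𝓝 p, ContDiffAt ℝ ∞ B q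
  ker : ∀ᶠ q in 𝓝 p, q.1 ∈ Icc (0 : ℝ) 1 → ∀ w, w ∈ D q ↔ B q w = 0

/-- `X` is tangent to the sphere and to `D` at `p`, and `(∂ₜ + ℒ_X) B` vanishes on `D` for every
defining form `B`: the infinitesimal form of preserving `D`. The Lie derivative restricted to `D`
is `∂_X B - ∂ B (X)`, because `B (X) = 0` along a field `X` with values in `D`. -/
structure IsGrayVector (D : ℝ × E → Submodule ℝ E) (p : ℝ × E) (X : E) : Prop where
  mem : X ∈ D p
  inner_eq_zero : ⟪p.2, X⟫ = 0
  fderiv_eq : ∀ B, IsDefiningForm D p B → ∀ w ∈ D p,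
    fderiv ℝ B p (1, X) w = fderiv ℝ B p (0, w) X

/-- A smooth family `D (t, ·)`, `t ∈ [0,1]`, of hyperplane fields on `E \ 0` that are invariant
under homotheties, contain the radial direction and induce contact structures on the sphere. -/
structure IsConicContact (D : ℝ × E → Submodule ℝ E) : Prop where
  exists_form : ∀ t ∈ Icc (0 : ℝ) 1, ∀ y ≠ 0, ∃ B, IsDefiningForm D (t, y) B
  conic : ∀ t ∈ Icc (0 : ℝ) 1, ∀ y ≠ 0, ∀ c : ℝ, 0 < c → D (t, c • y) = D (t, y)
  radial : ∀ t ∈ Icc (0 : ℝ) 1, ∀ y ≠ 0, y ∈ D (t, y)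
  exists_notMem : ∀ t ∈ Icc (0 : ℝ) 1, ∀ y ≠ 0, ∃ e, e ∉ D (t, y)
  nondegenerate : ∀ t ∈ Icc (0 : ℝ) 1, ∀ y ≠ 0, ∃ A : E → E →L[ℝ] ℝ, DifferentiableAt ℝ A y ∧
    (∀ᶠ z in 𝓝 y, ∀ w, w ∈ D (t, z) ↔ A z w = 0) ∧
    ∀ X ∈ D (t, y), ⟪y, X⟫ = 0 → (∀ w ∈ D (t, y), fderiv ℝ A y X w = fderiv ℝ A y w X) → X = 0

variable {D : ℝ × E → Submodule ℝ E} {p : ℝ × E} {B : ℝ × E → E →L[ℝ] ℝ}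

lemma uniqueDiffWithinAt_slab (hp : p.1 ∈ Icc (0 : ℝ) 1) :
    UniqueDiffWithinAt ℝ (Icc (0 : ℝ) 1 ×ˢ (univ : Set E)) p :=
  ((uniqueDiffOn_Icc zero_lt_one).prod uniqueDiffOn_univ) p ⟨hp, mem_univ _⟩

namespace IsDefiningForm

lemma eventually (h : IsDefiningForm D p B) : ∀ᶠ q in 𝓝 p, IsDefiningForm D q B := by
  filter_upwards [eventually_eventually_nhds.2 h.smooth, eventually_eventually_nhds.2 h.ker]
    with q hsmooth hker using ⟨hsmooth, hker⟩

lemma mem_iff (h : IsDefiningForm D p B) (hp : p.1 ∈ Icc (0 : ℝ) 1) (w : E) :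
    w ∈ D p ↔ B p w = 0 :=
  h.ker.self_of_nhds hp w

lemma contDiffAt (h : IsDefiningForm D p B) : ContDiffAt ℝ ∞ B p := h.smooth.self_of_nhds

lemma contDiffAt_fderiv (h : IsDefiningForm D p B) : ContDiffAt ℝ ∞ (fderiv ℝ B) p :=
  h.contDiffAt.fderiv_right (by simp)

lemma hasFDerivAt (h : IsDefiningForm D p B) : HasFDerivAt B (fderiv ℝ B p) p :=
  (h.contDiffAt.differentiableAt (by simp)).hasFDerivAt

lemma fderiv_mul_comm {B' : ℝ × E → E →L[ℝ] ℝ} (h : IsDefiningForm D p B)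
    (h' : IsDefiningForm D p B') (hp : p.1 ∈ Icc (0 : ℝ) 1) {w : E} (hw : w ∈ D p) (e : E)
    (v : ℝ × E) : fderiv ℝ B' p v w * B p e = fderiv ℝ B p v w * B' p e := by
  refine fderiv_apply_mul_comm (uniqueDiffWithinAt_slab hp) ⟨hp, mem_univ _⟩
    h.hasFDerivAt.differentiableAt h'.hasFDerivAt.differentiableAt ?_ ((h.mem_iff hp w).1 hw) e v
  filter_upwards [mem_nhdsWithin_of_mem_nhds h.ker, mem_nhdsWithin_of_mem_nhds h'.ker,
    self_mem_nhdsWithin] with q hker hker' hq w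
  rw [← hker hq.1, ← hker' hq.1]

lemma fderiv_apply_eq_neg (h : IsDefiningForm D p B) (hp : p.1 ∈ Icc (0 : ℝ) 1)
    {Z : ℝ × E → E} {Z' : ℝ × E →L[ℝ] E} (hZ : HasFDerivAt Z Z' p)
    (hmem : ∀ᶠ q in 𝓝 p, q.1 ∈ Icc (0 : ℝ) 1 → Z q ∈ D q) (v : ℝ × E) :
    fderiv ℝ B p v (Z p) = -B p (Z' v) := by
  have := hasFDerivAt_eq_zero (uniqueDiffWithinAt_slab hp) ⟨hp, mem_univ _⟩
    (h.hasFDerivAt.clm_apply hZ) (by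
      filter_upwards [mem_nhdsWithin_of_mem_nhds h.ker, mem_nhdsWithin_of_mem_nhds hmem,
        self_mem_nhdsWithin] with q hker hq ht using (hker ht.1 _).1 (hq ht.1))
  have := congrArg (fun L : ℝ × E →L[ℝ] ℝ => L v) this
  simp only [add_apply, ContinuousLinearMap.comp_apply, ContinuousLinearMap.flip_apply,
    zero_apply] at this
  linarith

end IsDefiningForm

namespace IsConicContact

lemma exists_apply_ne_zero (hD : IsConicContact D) (h : IsDefiningForm D p B)
    (hp : p.1 ∈ Icc (0 : ℝ) 1) (hp₂ : p.2 ≠ 0) : ∃ e, B p e ≠ 0 := by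
  obtain ⟨e, he⟩ := hD.exists_notMem p.1 hp p.2 hp₂
  exact ⟨e, fun h0 => he ((h.mem_iff hp e).2 h0)⟩

lemma fderiv_apply_radial (hD : IsConicContact D) (h : IsDefiningForm D p B)
    (hp : p.1 ∈ Icc (0 : ℝ) 1) (hp₂ : p.2 ≠ 0) {X : E} (hX : X ∈ D p) (τ : ℝ) :
    fderiv ℝ B p (τ, X) p.2 = 0 := by
  rw [h.fderiv_apply_eq_neg hp hasFDerivAt_snd ?_ (τ, X)]
  · simpa using (h.mem_iff hp X).1 hX
  · filter_upwards [continuousAt_snd.eventually_ne hp₂] with q hq ht using hD.radial q.1 ht q.2 hq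

lemma fderiv_radial_apply (hD : IsConicContact D) (h : IsDefiningForm D p B)
    (hp : p.1 ∈ Icc (0 : ℝ) 1) (hp₂ : p.2 ≠ 0) {X : E} (hX : X ∈ D p) :
    fderiv ℝ B p (0, p.2) X = 0 := by
  let ray (s : ℝ) : ℝ × E := (p.1, (1 + s) • p.2)
  have ray_zero : ray 0 = p := by simp [ray]
  have hray : HasDerivAt ray (0, p.2) 0 :=
    (hasDerivAt_const _ _).prodMk (by
      simpa using! ((hasDerivAt_id (0 : ℝ)).const_add 1).smul_const p.2)
  have along_ray : HasDerivAt (fun s => B (ray s) X) (fderiv ℝ B p (0, p.2) X) 0 := by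
    simpa using (HasFDerivAt.comp_hasDerivAt (0 : ℝ) (l := B)
      (by rw [ray_zero]; exact h.hasFDerivAt) hray).clm_apply (hasDerivAt_const 0 X)
  have vanishes : (fun s => B (ray s) X) =ᶠ[𝓝 0] fun _ => 0 := by
    have tendsto_ray : Tendsto ray (𝓝 0) (𝓝 p) := by
      simpa only [ray_zero] using hray.continuousAt.tendsto
    filter_upwards [tendsto_ray.eventually h.ker,
      eventually_gt_nhds (show (-1 : ℝ) < 0 by norm_num)] with s hker hs
    refine (hker hp X).1 ?_
    rwa [hD.conic p.1 hp p.2 hp₂ (1 + s) (by linarith)]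
  exact (along_ray.congr_of_eventuallyEq vanishes.symm).unique (hasDerivAt_const 0 (0 : ℝ))

lemma eq_zero_of_fderiv_comm (hD : IsConicContact D) (h : IsDefiningForm D p B)
    (hp : p.1 ∈ Icc (0 : ℝ) 1) (hp₂ : p.2 ≠ 0) {X : E} (hX : X ∈ D p) (horth : ⟪p.2, X⟫ = 0)
    (hcomm : ∀ w ∈ D p, fderiv ℝ B p (0, X) w = fderiv ℝ B p (0, w) X) : X = 0 := by
  obtain ⟨A, hA, hker, hnondeg⟩ := hD.nondegenerate p.1 hp p.2 hp₂
  obtain ⟨e, he⟩ := hD.exists_apply_ne_zero h hp hp₂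
  have slice := SmoothFlow.hasFDerivAt_comp_prodMk h.hasFDerivAt
  have proportional (v : E) {w : E} (hw : w ∈ D p) :
      fderiv ℝ A p.2 v w * B p e = fderiv ℝ B p (0, v) w * A p.2 e := by
    have := fderiv_apply_mul_comm (uniqueDiffWithinAt_univ (x := p.2)) (mem_univ _)
      slice.differentiableAt hA (by
        have tendsto_slice : Tendsto (fun z => (p.1, z)) (𝓝 p.2) (𝓝 p) :=
          (Continuous.prodMk_right p.1).tendsto p.2
        rw [nhdsWithin_univ]
        filter_upwards [tendsto_slice.eventually h.ker, hker] with z hB hA w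
        rw [← hB hp, ← hA]) ((h.mem_iff hp w).1 hw) e v
    rw [slice.fderiv] at this
    simpa using this
  refine hnondeg X hX horth fun w hw => mul_right_cancel₀ he ?_
  rw [proportional X hw, proportional w hX, hcomm w hw]

lemma eq_of_isGrayVector (hD : IsConicContact D) (hp : p.1 ∈ Icc (0 : ℝ) 1) (hp₂ : p.2 ≠ 0)
    {X Y : E} (hX : IsGrayVector D p X) (hY : IsGrayVector D p Y) : X = Y := by
  obtain ⟨B, hB⟩ := hD.exists_form p.1 hp p.2 hp₂
  refine sub_eq_zero.1 (hD.eq_zero_of_fderiv_comm hB hp hp₂ (sub_mem hX.mem hY.mem) ?_ ?_)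
  · rw [inner_sub_right, hX.inner_eq_zero, hY.inner_eq_zero, sub_zero]
  · intro w hw
    have time_cancels : ((0 : ℝ), X - Y) = (1, X) - (1, Y) := by simp
    rw [time_cancels, map_sub, map_sub, sub_apply, hX.fderiv_eq B hB w hw,
      hY.fderiv_eq B hB w hw]

lemma isGrayVector_of_form (hD : IsConicContact D) (h : IsDefiningForm D p B)
    (hp : p.1 ∈ Icc (0 : ℝ) 1) (hp₂ : p.2 ≠ 0) {X : E} (hX : X ∈ D p) (horth : ⟪p.2, X⟫ = 0)
    (heq : ∀ w ∈ D p, fderiv ℝ B p (1, X) w = fderiv ℝ B p (0, w) X) : IsGrayVector D p X := by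
  refine ⟨hX, horth, fun B' h' w hw => ?_⟩
  obtain ⟨e, he⟩ := hD.exists_apply_ne_zero h hp hp₂
  refine mul_right_cancel₀ he ?_
  rw [h.fderiv_mul_comm h' hp hw, h.fderiv_mul_comm h' hp hX, heq w hw]

end IsConicContact
end ConicGray

/-! ### Existence of a smooth Gray field -/

namespace ConicGray

section Shell

variable {E : Type*} [NormedAddCommGroup E] {p : ℝ × E}

/-- A neighbourhood of `[0,1] × S` in `[0,1] × E`, for the unit sphere `S`, on which the homogeneous
distributions have to be preserved. -/
def shell (E : Type*) [NormedAddCommGroup E] : Set (ℝ × E) :=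
  Icc (0 : ℝ) 1 ×ˢ (norm ⁻¹' Icc (1 / 2 : ℝ) 2)

lemma isClosed_shell : IsClosed (shell E) :=
  isClosed_Icc.prod (isClosed_Icc.preimage continuous_norm)

lemma ne_zero_of_mem_shell (hp : p ∈ shell E) : p.2 ≠ 0 := fun h0 => by
  have : (1 / 2 : ℝ) ≤ ‖p.2‖ := hp.2.1
  norm_num [h0] at this

lemma norm_lt_three_of_mem_shell (hp : p ∈ shell E) : ‖p‖ < 3 := by
  obtain ⟨⟨ht₀, ht₁⟩, -, hnorm⟩ := hp
  rw [Prod.norm_def, max_lt_iff, Real.norm_eq_abs, abs_of_nonneg ht₀]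
  exact ⟨by linarith, by linarith⟩

lemma mk_mem_shell {t : ℝ} (ht : t ∈ Icc (0 : ℝ) 1) {y : E} (hy : ‖y‖ = 1) : (t, y) ∈ shell E :=
  ⟨ht, by norm_num [hy]⟩

lemma eventually_mem_shell (hp : ‖p.2‖ = 1) :
    ∀ᶠ q in 𝓝 p, q.1 ∈ Icc (0 : ℝ) 1 → q ∈ shell E := by
  have near_sphere : ∀ᶠ q in 𝓝 p, ‖q.2‖ ∈ Icc (1 / 2 : ℝ) 2 :=
    continuous_snd.norm.continuousAt.eventually (Icc_mem_nhds (by norm_num [hp]) (by norm_num [hp]))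
  filter_upwards [near_sphere] with q hq ht using ⟨ht, hq⟩

end Shell

variable {E : Type u} [NormedAddCommGroup E] [InnerProductSpace ℝ E]
variable {D : ℝ × E → Submodule ℝ E} {p : ℝ × E} {B : ℝ × E → E →L[ℝ] ℝ}

section LinearSystem

/-- The linear system `(X, l, m) ↦ (∂_X B - ∂ B (X) + l B + m ⟪q, ·⟫, B (X), ⟪q, X⟫)`. The
multipliers `l` and `m` make it square, and the multiplier `m` vanishes on the solutions. -/
noncomputable def grayMap (B : ℝ × E → E →L[ℝ] ℝ) (q : ℝ × E) :
    E × ℝ × ℝ →L[ℝ] (E →L[ℝ] ℝ) × ℝ × ℝ :=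
  let M : E →L[ℝ] E →L[ℝ] ℝ := (fderiv ℝ B q).comp (.inr ℝ ℝ E)
  ((M - M.flip).comp (.fst ℝ E (ℝ × ℝ)) +
    ((ContinuousLinearMap.fst ℝ ℝ ℝ).comp (.snd ℝ E (ℝ × ℝ))).smulRight (B q) +
    ((ContinuousLinearMap.snd ℝ ℝ ℝ).comp (.snd ℝ E (ℝ × ℝ))).smulRight (innerSL ℝ q.2)).prod
  (((B q).comp (.fst ℝ E (ℝ × ℝ))).prod ((innerSL ℝ q.2).comp (.fst ℝ E (ℝ × ℝ))))

lemma grayMap_apply (B : ℝ × E → E →L[ℝ] ℝ) (q : ℝ × E) (v : E × ℝ × ℝ) :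
    grayMap B q v = ((fderiv ℝ B q (0, v.1) - ((fderiv ℝ B q).comp (.inr ℝ ℝ E)).flip v.1 +
      v.2.1 • B q + v.2.2 • innerSL ℝ q.2), B q v.1, ⟪q.2, v.1⟫) := by
  simp [grayMap]

/-- The value at `q` of the vector field determined by the defining form `B`. It is meaningful only
where `grayMap B q` is invertible. -/
noncomputable def grayVector (B : ℝ × E → E →L[ℝ] ℝ) (q : ℝ × E) : E :=
  ((grayMap B q).inverse (-fderiv ℝ B q (1, 0), 0, 0)).1

lemma IsConicContact.of_grayMap_eq (hD : IsConicContact D) (h : IsDefiningForm D p B)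
    (hp : p.1 ∈ Icc (0 : ℝ) 1) (hp₂ : p.2 ≠ 0) {v : E × ℝ × ℝ} {η : E →L[ℝ] ℝ}
    (hv : grayMap B p v = (η, 0, 0)) (hη : η p.2 = 0) :
    v.1 ∈ D p ∧ ⟪p.2, v.1⟫ = 0 ∧ v.2.2 = 0 ∧
      ∀ w, fderiv ℝ B p (0, v.1) w - fderiv ℝ B p (0, w) v.1 + v.2.1 * B p w = η w := by
  rw [grayMap_apply, Prod.mk.injEq, Prod.mk.injEq] at hv
  obtain ⟨heq, hBv, horth⟩ := hv
  have hmem : v.1 ∈ D p := (h.mem_iff hp _).2 hBv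
  have apply_eq (w : E) : fderiv ℝ B p (0, v.1) w - fderiv ℝ B p (0, w) v.1 + v.2.1 * B p w +
      v.2.2 * ⟪p.2, w⟫ = η w := by
    simpa using congrArg (fun L : E →L[ℝ] ℝ => L w) heq
  have multiplier : v.2.2 = 0 := by
    have radial := apply_eq p.2
    rw [hD.fderiv_apply_radial h hp hp₂ hmem, hD.fderiv_radial_apply h hp hp₂ hmem,
      (h.mem_iff hp _).1 (hD.radial p.1 hp p.2 hp₂), hη] at radial
    simpa [hp₂] using radial
  exact ⟨hmem, horth, multiplier, fun w => by simpa [multiplier] using apply_eq w⟩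

lemma IsConicContact.grayMap_injective (hD : IsConicContact D) (h : IsDefiningForm D p B)
    (hp : p.1 ∈ Icc (0 : ℝ) 1) (hp₂ : p.2 ≠ 0) : Function.Injective (grayMap B p) := by
  rw [injective_iff_map_eq_zero]
  rintro ⟨X, l, m⟩ hv
  obtain ⟨hmem, horth, rfl, heq⟩ := hD.of_grayMap_eq h hp hp₂ hv (zero_apply _)
  obtain rfl : X = 0 := hD.eq_zero_of_fderiv_comm h hp hp₂ hmem horth fun w hw => by
    have := heq w
    rwa [(h.mem_iff hp w).1 hw, mul_zero, add_zero, zero_apply, sub_eq_zero] at this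
  obtain ⟨e, he⟩ := hD.exists_apply_ne_zero h hp hp₂
  obtain rfl : l = 0 := by simpa [he, ← Prod.zero_eq_mk] using heq e
  rfl

lemma inner_grayVector {q : ℝ × E} (hinv : (grayMap B q).IsInvertible) :
    ⟪q.2, grayVector B q⟫ = 0 := by
  have := hinv.self_apply_inverse (-fderiv ℝ B q (1, 0), 0, 0)
  rw [grayMap_apply, Prod.mk.injEq, Prod.mk.injEq] at this
  exact this.2.2

lemma IsConicContact.isGrayVector_grayVector (hD : IsConicContact D) (h : IsDefiningForm D p B)
    (hp : p.1 ∈ Icc (0 : ℝ) 1) (hp₂ : p.2 ≠ 0) (hinv : (grayMap B p).IsInvertible) :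
    IsGrayVector D p (grayVector B p) := by
  obtain ⟨hmem, horth, -, heq⟩ := hD.of_grayMap_eq h hp hp₂ (hinv.self_apply_inverse _)
    (by rw [neg_apply, hD.fderiv_apply_radial h hp hp₂ (zero_mem _) 1, neg_zero])
  refine hD.isGrayVector_of_form h hp hp₂ hmem horth fun w hw => ?_
  have := heq w
  rw [(h.mem_iff hp w).1 hw, mul_zero, add_zero, neg_apply, sub_eq_iff_eq_add] at this
  have split : ((1 : ℝ), grayVector B p) = (1, 0) + (0, grayVector B p) := by simp
  rw [split, map_add, add_apply, grayVector, this]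
  abel

variable [FiniteDimensional ℝ E]

lemma isInvertible_grayMap {q : ℝ × E} (hinj : Function.Injective (grayMap B q)) :
    (grayMap B q).IsInvertible := by
  have finrank_dual : Module.finrank ℝ E = Module.finrank ℝ (E →L[ℝ] ℝ) :=
    (InnerProductSpace.toDual ℝ E).toLinearEquiv.finrank_eq
  exact ⟨(LinearEquiv.ofInjectiveOfFinrankEq (grayMap B q).toLinearMap hinj
    (by simp [finrank_dual])).toContinuousLinearEquiv, ContinuousLinearMap.ext fun _ => rfl⟩

lemma IsDefiningForm.contDiffAt_grayMap (h : IsDefiningForm D p B) :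
    ContDiffAt ℝ ∞ (grayMap B) p := by
  refine contDiffAt_clm_apply_iff.2 fun v => ?_
  simp only [grayMap_apply]
  refine ContDiffAt.prodMk (((ContDiffAt.sub ?_ ?_).add ?_).add ?_) (ContDiffAt.prodMk ?_ ?_)
  · exact h.contDiffAt_fderiv.clm_apply contDiffAt_const
  · exact contDiffAt_clm_apply_iff.2 fun w =>
      ((h.contDiffAt_fderiv.clm_comp contDiffAt_const).clm_apply contDiffAt_const).clm_apply
        contDiffAt_const
  · exact contDiffAt_const.fun_smul h.contDiffAt
  · exact contDiffAt_const.fun_smul ((innerSL ℝ).contDiff.contDiffAt.comp p contDiffAt_snd)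
  · exact h.contDiffAt.clm_apply contDiffAt_const
  · exact contDiffAt_snd.inner ℝ contDiffAt_const

lemma IsConicContact.eventually_isInvertible_grayMap (hD : IsConicContact D)
    (h : IsDefiningForm D p B) (hp : p.1 ∈ Icc (0 : ℝ) 1) (hp₂ : p.2 ≠ 0) :
    ∀ᶠ q in 𝓝 p, (grayMap B q).IsInvertible :=
  h.contDiffAt_grayMap.continuousAt.eventually <| ContinuousLinearEquiv.isOpen.mem_nhds
    (isInvertible_grayMap (hD.grayMap_injective h hp hp₂))

lemma IsDefiningForm.contDiffAt_grayVector (h : IsDefiningForm D p B)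
    (hinv : (grayMap B p).IsInvertible) : ContDiffAt ℝ ∞ (grayVector B) p :=
  ((hinv.contDiffAt_map_inverse.comp p h.contDiffAt_grayMap).clm_apply
    ((h.contDiffAt_fderiv.clm_apply contDiffAt_const).neg.prodMk contDiffAt_const)).fst

lemma IsConicContact.exists_local_grayVector (hD : IsConicContact D) (hp : p.1 ∈ Icc (0 : ℝ) 1)
    (hp₂ : p.2 ≠ 0) : ∃ g : ℝ × E → E, ∀ᶠ q in 𝓝 p, ContDiffAt ℝ ∞ g q ∧ ⟪q.2, g q⟫ = 0 ∧
      (q.1 ∈ Icc (0 : ℝ) 1 → IsGrayVector D q (g q)) := by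
  obtain ⟨B, hB⟩ := hD.exists_form p.1 hp p.2 hp₂
  refine ⟨grayVector B, ?_⟩
  filter_upwards [hD.eventually_isInvertible_grayMap hB hp hp₂, hB.eventually,
    continuousAt_snd.eventually_ne hp₂] with q hinv hBq hq₂
  exact ⟨hBq.contDiffAt_grayVector hinv, inner_grayVector hinv, fun hq =>
    hD.isGrayVector_grayVector hBq hq hq₂ hinv⟩

end LinearSystem

section VectorField

/-- A compactly supported time-dependent vector field, tangent to the spheres centred at `0`, that
consists of Gray vectors near the unit sphere. -/
structure IsGrayField (D : ℝ × E → Submodule ℝ E) (Y : ℝ × E → E) : Prop where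
  contDiff : ContDiff ℝ ∞ Y
  hasCompactSupport : HasCompactSupport Y
  inner_eq_zero : ∀ q, ⟪q.2, Y q⟫ = 0
  isGrayVector : ∀ q ∈ shell E, IsGrayVector D q (Y q)

/-- The admissible values at `q` of a Gray field vanishing outside the ball of radius `3`. -/
def grayValues (D : ℝ × E → Submodule ℝ E) (q : ℝ × E) : Set E :=
  {X | ⟪q.2, X⟫ = 0 ∧ (3 ≤ ‖q‖ → X = 0) ∧ (q ∈ shell E → IsGrayVector D q X)}

lemma IsConicContact.convex_grayValues (hD : IsConicContact D) (q : ℝ × E) :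
    Convex ℝ (grayValues D q) := by
  rintro X ⟨hX, hX₀, hXG⟩ Z ⟨hZ, hZ₀, hZG⟩ a b - - hab
  refine ⟨?_, fun hq => ?_, fun hq => ?_⟩
  · rw [inner_add_right, inner_smul_right, inner_smul_right, hX, hZ, mul_zero, mul_zero, add_zero]
  · rw [hX₀ hq, hZ₀ hq, smul_zero, smul_zero, add_zero]
  · rw [← hD.eq_of_isGrayVector hq.1 (ne_zero_of_mem_shell hq) (hXG hq) (hZG hq), ← add_smul, hab,
      one_smul]
    exact hXG hq

variable [FiniteDimensional ℝ E]

lemma IsConicContact.exists_local_section (hD : IsConicContact D) (q : ℝ × E) :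
    ∃ U ∈ 𝓝 q, ∃ g : ℝ × E → E, ContMDiffOn 𝓘(ℝ, ℝ × E) 𝓘(ℝ, E) ∞ g U ∧
      ∀ z ∈ U, g z ∈ grayValues D z := by
  by_cases hq : q ∈ shell E
  · obtain ⟨g, hg⟩ := hD.exists_local_grayVector hq.1 (ne_zero_of_mem_shell hq)
    refine ⟨_, hg.and (continuous_norm.continuousAt.eventually_lt continuousAt_const
      (norm_lt_three_of_mem_shell hq)), g, fun z hz => hz.1.1.contMDiffAt.contMDiffWithinAt,
      fun z hz => ⟨hz.1.2.1, fun h => absurd hz.2 (not_lt.2 h), fun h => hz.1.2.2 h.1⟩⟩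
  · exact ⟨(shell E)ᶜ, isClosed_shell.isOpen_compl.mem_nhds hq, 0, contMDiffOn_const,
      fun z hz => ⟨inner_zero_right _, fun _ => rfl, fun h => absurd h hz⟩⟩

theorem IsConicContact.exists_isGrayField (hD : IsConicContact D) : ∃ Y, IsGrayField D Y := by
  obtain ⟨Y, hY⟩ := exists_contMDiffMap_forall_mem_convex_of_local (n := ⊤) 𝓘(ℝ, ℝ × E)
    hD.convex_grayValues hD.exists_local_section
  refine ⟨Y, Y.contMDiff.contDiff, ?_, fun q => (hY q).1, fun q => (hY q).2.2⟩
  refine HasCompactSupport.intro (isCompact_closedBall 0 3) fun q hq => (hY q).2.1 ?_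
  rw [Metric.mem_closedBall, dist_zero_right, not_le] at hq
  exact hq.le

theorem IsGrayField.exists_isEvolution {Y : ℝ × E → E} (hY : IsGrayField D Y) :
    ∃ Ψ : ℝ → E → E, SmoothFlow.IsEvolution Y Ψ ∧ ContDiff ℝ ∞ (fun q : ℝ × E => Ψ q.1 q.2) ∧
      ∀ t, ∃ Φ : E ≃ₘ^∞⟮𝓘(ℝ, E), 𝓘(ℝ, E)⟯ E, ⇑Φ = Ψ t := by
  obtain ⟨K, hK⟩ := hY.contDiff.lipschitzWith_of_hasCompactSupport hY.hasCompactSupport (by simp)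
  obtain ⟨C, hC⟩ := hY.hasCompactSupport.exists_bound_of_continuous hY.contDiff.continuous
  exact SmoothFlow.exists_isEvolution (by simp) hY.contDiff hK hC

end VectorField

end ConicGray

/-! ### Symmetries and transport along a Gray field -/

namespace ConicGray

variable {E : Type u} [NormedAddCommGroup E] [InnerProductSpace ℝ E]
variable {D : ℝ × E → Submodule ℝ E} {p : ℝ × E} {B : ℝ × E → E →L[ℝ] ℝ}

section Symmetry

/-- `U` is a smooth self-map of `E \ 0` that preserves the norm and all the distributions
`D (t, ·)`, `t ∈ [0,1]`. -/
structure IsSymmetry (D : ℝ × E → Submodule ℝ E) (U : E → E) : Prop where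
  smooth : ∀ y ≠ 0, ContDiffAt ℝ ∞ U y
  norm_eq : ∀ y ≠ 0, ‖U y‖ = ‖y‖
  mem_iff : ∀ t ∈ Icc (0 : ℝ) 1, ∀ y ≠ 0, ∀ w, w ∈ D (t, y) ↔ fderiv ℝ U y w ∈ D (t, U y)

/-- The pullback of a time-dependent family of forms by a self-map of `E`. -/
noncomputable def pullback (U : E → E) (B : ℝ × E → E →L[ℝ] ℝ) (q : ℝ × E) : E →L[ℝ] ℝ :=
  (B (q.1, U q.2)).comp (fderiv ℝ U q.2)

namespace IsSymmetry

variable {U : E → E}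

lemma ne_zero (hU : IsSymmetry D U) {y : E} (hy : y ≠ 0) : U y ≠ 0 := by
  rw [← norm_ne_zero_iff, hU.norm_eq y hy]
  exact norm_ne_zero_iff.2 hy

lemma hasFDerivAt (hU : IsSymmetry D U) {y : E} (hy : y ≠ 0) : HasFDerivAt U (fderiv ℝ U y) y :=
  ((hU.smooth y hy).differentiableAt (by simp)).hasFDerivAt

lemma contDiffAt_fderiv (hU : IsSymmetry D U) {y : E} (hy : y ≠ 0) :
    ContDiffAt ℝ ∞ (fderiv ℝ U) y :=
  (hU.smooth y hy).fderiv_right (by simp)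

lemma fderiv_fderiv_comm (hU : IsSymmetry D U) {y : E} (hy : y ≠ 0) (v w : E) :
    fderiv ℝ (fderiv ℝ U) y v w = fderiv ℝ (fderiv ℝ U) y w v :=
  ((hU.smooth y hy).isSymmSndFDerivAt
    (by simpa using WithTop.coe_le_coe.2 (le_top (a := (2 : ℕ∞))))).eq v w

lemma inner_fderiv (hU : IsSymmetry D U) {y : E} (hy : y ≠ 0) (w : E) :
    ⟪U y, fderiv ℝ U y w⟫ = ⟪y, w⟫ := by
  have norm_sq_eq : (fun z => ‖U z‖ ^ 2) =ᶠ[𝓝 y] fun z => ‖id z‖ ^ 2 := by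
    filter_upwards [eventually_ne_nhds hy] with z hz
    rw [hU.norm_eq z hz, id]
  have := (hU.hasFDerivAt hy).norm_sq.unique
    ((hasFDerivAt_id (𝕜 := ℝ) y).norm_sq.congr_of_eventuallyEq norm_sq_eq)
  simpa using congrArg (fun L : E →L[ℝ] ℝ => L w) this

lemma isDefiningForm_pullback (hU : IsSymmetry D U) (hp₂ : p.2 ≠ 0)
    (hB : IsDefiningForm D (p.1, U p.2) B) : IsDefiningForm D p (pullback U B) := by
  have tendsto : Tendsto (fun q : ℝ × E => (q.1, U q.2)) (𝓝 p) (𝓝 (p.1, U p.2)) :=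
    continuousAt_fst.prodMk ((hU.smooth p.2 hp₂).continuousAt.comp continuousAt_snd)
  have hne : ∀ᶠ q : ℝ × E in 𝓝 p, q.2 ≠ 0 := continuousAt_snd.eventually_ne hp₂
  constructor
  · filter_upwards [tendsto.eventually hB.smooth, hne] with q hBq hq
    exact (hBq.comp q (contDiffAt_fst.prodMk ((hU.smooth q.2 hq).comp q contDiffAt_snd))).clm_comp
      ((hU.contDiffAt_fderiv hq).comp q contDiffAt_snd)
  · filter_upwards [tendsto.eventually hB.ker, hne] with q hBq hq ht w
    exact (hU.mem_iff q.1 ht q.2 hq w).trans (hBq ht _)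

lemma fderiv_pullback (hU : IsSymmetry D U) (hp₂ : p.2 ≠ 0)
    (hB : IsDefiningForm D (p.1, U p.2) B) (τ : ℝ) (v w : E) :
    fderiv ℝ (pullback U B) p (τ, v) w =
      fderiv ℝ B (p.1, U p.2) (τ, fderiv ℝ U p.2 v) (fderiv ℝ U p.2 w) +
        B (p.1, U p.2) (fderiv ℝ (fderiv ℝ U) p.2 v w) := by
  have deriv_base : HasFDerivAt (fun q : ℝ × E => (q.1, U q.2))
      ((ContinuousLinearMap.fst ℝ ℝ E).prod ((fderiv ℝ U p.2).comp (.snd ℝ ℝ E))) p :=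
    hasFDerivAt_fst.prodMk ((hU.hasFDerivAt hp₂).comp p hasFDerivAt_snd)
  have deriv_fiber : HasFDerivAt (fun q : ℝ × E => fderiv ℝ U q.2)
      ((fderiv ℝ (fderiv ℝ U) p.2).comp (.snd ℝ ℝ E)) p :=
    ((hU.contDiffAt_fderiv hp₂).differentiableAt (by simp)).hasFDerivAt.comp p hasFDerivAt_snd
  have deriv_pullback : HasFDerivAt (pullback U B) _ p :=
    (HasFDerivAt.comp p (f := fun q : ℝ × E => (q.1, U q.2)) hB.hasFDerivAt
      deriv_base).clm_comp deriv_fiber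
  rw [deriv_pullback.fderiv]
  simp [add_comm]

lemma fderiv_injective (hU : IsSymmetry D U) (hD : IsConicContact D) (hp : p.1 ∈ Icc (0 : ℝ) 1)
    (hp₂ : p.2 ≠ 0) : Function.Injective (fderiv ℝ U p.2) := by
  rw [injective_iff_map_eq_zero]
  intro X hX
  obtain ⟨B, hB⟩ := hD.exists_form p.1 hp (U p.2) (hU.ne_zero hp₂)
  refine hD.eq_zero_of_fderiv_comm (hU.isDefiningForm_pullback hp₂ hB) hp hp₂
    ((hU.mem_iff p.1 hp p.2 hp₂ X).2 (by rw [hX]; exact zero_mem _))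
    (by rw [← hU.inner_fderiv hp₂, hX, inner_zero_right]) fun w _ => ?_
  rw [hU.fderiv_pullback hp₂ hB, hU.fderiv_pullback hp₂ hB, hX, hU.fderiv_fderiv_comm hp₂ X w,
    map_zero, ← Prod.zero_eq_mk, map_zero, zero_apply]

lemma isGrayVector [FiniteDimensional ℝ E] (hU : IsSymmetry D U) (hD : IsConicContact D)
    (hp : p.1 ∈ Icc (0 : ℝ) 1) (hp₂ : p.2 ≠ 0) {X : E} (hX : IsGrayVector D p X) :
    IsGrayVector D (p.1, U p.2) (fderiv ℝ U p.2 X) := by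
  refine ⟨(hU.mem_iff p.1 hp p.2 hp₂ X).1 hX.mem,
    (hU.inner_fderiv hp₂ X).trans hX.inner_eq_zero, fun B hB w hw => ?_⟩
  obtain ⟨w, rfl⟩ := LinearMap.injective_iff_surjective.1 (hU.fderiv_injective hD hp hp₂) w
  have := hX.fderiv_eq _ (hU.isDefiningForm_pullback hp₂ hB) w
    ((hU.mem_iff p.1 hp p.2 hp₂ w).2 hw)
  rw [hU.fderiv_pullback hp₂ hB, hU.fderiv_pullback hp₂ hB, hU.fderiv_fderiv_comm hp₂ X w] at this
  exact add_right_cancel this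

end IsSymmetry

end Symmetry

section Transport

/-- The equations `g' = μ g` have unique solutions in both directions of time. -/
lemma eq_zero_iff_of_linear_ode {g μ : ℝ → ℝ} {K a b : ℝ} (hab : a ≤ b)
    (hμ : ∀ t ∈ Icc a b, |μ t| ≤ K) (hg : ∀ t ∈ Icc a b, HasDerivAt g (μ t * g t) t) :
    g a = 0 ↔ g b = 0 := by
  have lipschitz (t : ℝ) (ht : t ∈ Icc a b) :
      LipschitzOnWith K.toNNReal (fun y => μ t * y) univ :=
    (LipschitzWith.of_dist_le_mul fun x y => by
      rw [Real.dist_eq, Real.dist_eq, ← mul_sub, abs_mul]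
      exact mul_le_mul_of_nonneg_right ((hμ t ht).trans (Real.le_coe_toNNReal K))
        (abs_nonneg _)).lipschitzOnWith
  have zero_solution (t : ℝ) : HasDerivAt (fun _ : ℝ => (0 : ℝ)) (μ t * 0) t := by
    simpa using hasDerivAt_const t (0 : ℝ)
  have hcont : ContinuousOn g (Icc a b) := fun t ht => (hg t ht).continuousAt.continuousWithinAt
  constructor <;> intro h0
  · exact ODE_solution_unique_of_mem_Icc_right (fun t ht => lipschitz t (Ico_subset_Icc_self ht))
      hcont (fun t ht => (hg t (Ico_subset_Icc_self ht)).hasDerivWithinAt) (fun _ _ => mem_univ _)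
      continuousOn_const (fun t _ => (zero_solution t).hasDerivWithinAt) (fun _ _ => mem_univ _) h0
      (right_mem_Icc.2 hab)
  · exact ODE_solution_unique_of_mem_Icc_left (fun t ht => lipschitz t (Ioc_subset_Icc_self ht))
      hcont (fun t ht => (hg t (Ioc_subset_Icc_self ht)).hasDerivWithinAt) (fun _ _ => mem_univ _)
      continuousOn_const (fun t _ => (zero_solution t).hasDerivWithinAt) (fun _ _ => mem_univ _) h0
      (left_mem_Icc.2 hab)

lemma eventually_eq_zero_iff_of_linear_ode {g μ : ℝ → ℝ} {s : Set ℝ} (hs : s.OrdConnected)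
    {t₀ : ℝ} (ht₀ : t₀ ∈ s) (hμ : ContinuousAt μ t₀)
    (hg : ∀ᶠ t in 𝓝 t₀, t ∈ s → HasDerivAt g (μ t * g t) t) :
    ∀ᶠ t in 𝓝[s] t₀, g t₀ = 0 ↔ g t = 0 := by
  have bounded : ∀ᶠ t in 𝓝 t₀, |μ t| < |μ t₀| + 1 :=
    hμ.abs.eventually_lt continuousAt_const (by simp)
  obtain ⟨δ, hδ, hball⟩ := Metric.eventually_nhds_iff_ball.1 (hg.and bounded)
  filter_upwards [mem_nhdsWithin_of_mem_nhds (Metric.ball_mem_nhds t₀ hδ), self_mem_nhdsWithin]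
    with t ht hts
  have hball' : (Metric.ball t₀ δ).OrdConnected := (convex_ball t₀ δ).ordConnected
  have ht₀' := Metric.mem_ball_self (x := t₀) hδ
  rcases le_total t₀ t with h | h
  · exact eq_zero_iff_of_linear_ode h (fun r hr => (hball r (hball'.out ht₀' ht hr)).2.le)
      fun r hr => (hball r (hball'.out ht₀' ht hr)).1 (hs.out ht₀ hts hr)
  · exact (eq_zero_iff_of_linear_ode h (fun r hr => (hball r (hball'.out ht ht₀' hr)).2.le)
      fun r hr => (hball r (hball'.out ht ht₀' hr)).1 (hs.out hts ht₀ hr)).symm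

/-- The factor `μ` in `(∂ₜ + ℒ_Y) B = μ B`, computed on a vector `e` with `B q e ≠ 0`. -/
noncomputable def lieMultiplier (B : ℝ × E → E →L[ℝ] ℝ) (Y : ℝ × E → E) (e : E) (q : ℝ × E) : ℝ :=
  (fderiv ℝ B q (1, Y q) e - fderiv ℝ B q (0, e) (Y q)) / B q e

variable {Y : ℝ × E → E} {e : E}

lemma IsGrayVector.fderiv_sub_eq_lieMultiplier_mul (hX : IsGrayVector D p (Y p))
    (hB : IsDefiningForm D p B) (hp : p.1 ∈ Icc (0 : ℝ) 1) (he : B p e ≠ 0) (w : E) :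
    fderiv ℝ B p (1, Y p) w - fderiv ℝ B p (0, w) (Y p) = lieMultiplier B Y e p * B p w := by
  have hmem : B p e • w - B p w • e ∈ D p := (hB.mem_iff hp _).2 (by simp [mul_comm])
  have expand : ((0 : ℝ), B p e • w - B p w • e) = B p e • (0, w) - B p w • (0, e) := by simp
  have := hX.fderiv_eq B hB _ hmem
  rw [expand] at this
  simp only [map_sub, map_smul, smul_eq_mul, sub_apply, smul_apply] at this
  rw [lieMultiplier]
  field_simp
  linear_combination this

lemma IsDefiningForm.continuousAt_lieMultiplier (h : IsDefiningForm D p B)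
    (hY : ContinuousAt Y p) (he : B p e ≠ 0) : ContinuousAt (lieMultiplier B Y e) p :=
  have hB' := h.contDiffAt_fderiv.continuousAt
  (((hB'.clm_apply (continuousAt_const.prodMk hY)).clm_apply continuousAt_const).sub
    ((hB'.clm_apply continuousAt_const).clm_apply hY)).div
    (h.contDiffAt.continuousAt.clm_apply continuousAt_const) he

lemma IsGrayField.hasDerivAt_apply (hY : IsGrayField D Y) {c W : ℝ → E} {t : ℝ}
    (hB : IsDefiningForm D (t, c t) B) (he : B (t, c t) e ≠ 0) (ht : t ∈ Icc (0 : ℝ) 1)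
    (hn : ‖c t‖ = 1) (hc : HasDerivAt c (Y (t, c t)) t)
    (hW : HasDerivAt W (fderiv ℝ Y (t, c t) (0, W t)) t) :
    HasDerivAt (fun s => B (s, c s) (W s))
      (lieMultiplier B Y e (t, c t) * B (t, c t) (W t)) t := by
  have deriv_form : HasDerivAt (fun s => B (s, c s)) (fderiv ℝ B (t, c t) (1, Y (t, c t))) t :=
    HasFDerivAt.comp_hasDerivAt (f := fun s => (s, c s)) t hB.hasFDerivAt
      ((hasDerivAt_id t).prodMk hc)
  have tangent := hB.fderiv_apply_eq_neg ht
    (hY.contDiff.differentiable (by simp) (t, c t)).hasFDerivAt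
    ((eventually_mem_shell hn).mono fun q hq hq₁ => (hY.isGrayVector q (hq hq₁)).mem) (0, W t)
  refine (deriv_form.clm_apply hW).congr_deriv ?_
  rw [← (hY.isGrayVector _ (mk_mem_shell ht hn)).fderiv_sub_eq_lieMultiplier_mul hB ht he, tangent,
    sub_neg_eq_add]

lemma IsGrayField.eventually_mem_iff (hY : IsGrayField D Y) (hD : IsConicContact D) {c W : ℝ → E}
    (hc : ∀ t, HasDerivAt c (Y (t, c t)) t)
    (hW : ∀ t, HasDerivAt W (fderiv ℝ Y (t, c t) (0, W t)) t) (hn : ∀ t, ‖c t‖ = 1) {t₀ : ℝ}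
    (ht₀ : t₀ ∈ Icc (0 : ℝ) 1) :
    ∀ᶠ t in 𝓝[Icc 0 1] t₀, W t₀ ∈ D (t₀, c t₀) ↔ W t ∈ D (t, c t) := by
  have hc₀ : c t₀ ≠ 0 := ne_zero_of_norm_ne_zero (by simp [hn])
  obtain ⟨B, hB⟩ := hD.exists_form t₀ ht₀ (c t₀) hc₀
  obtain ⟨e, he⟩ := hD.exists_apply_ne_zero hB ht₀ hc₀
  have graph : ContinuousAt (fun t => (t, c t)) t₀ := continuousAt_id.prodMk (hc t₀).continuousAt
  have hBe : ∀ᶠ t in 𝓝 t₀, B (t, c t) e ≠ 0 :=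
    graph.eventually
      ((hB.contDiffAt.continuousAt.clm_apply continuousAt_const).eventually_ne he)
  have ode : ∀ᶠ t in 𝓝 t₀, t ∈ Icc (0 : ℝ) 1 → HasDerivAt (fun s => B (s, c s) (W s))
      (lieMultiplier B Y e (t, c t) * B (t, c t) (W t)) t := by
    filter_upwards [graph.eventually hB.eventually, hBe] with t hBt het ht
    exact hY.hasDerivAt_apply hBt het ht (hn t) (hc t) (hW t)
  have continuousAt_multiplier : ContinuousAt (fun t => lieMultiplier B Y e (t, c t)) t₀ :=
    ContinuousAt.comp (g := lieMultiplier B Y e)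
      (hB.continuousAt_lieMultiplier hY.contDiff.continuous.continuousAt he) graph
  filter_upwards [eventually_eq_zero_iff_of_linear_ode ordConnected_Icc ht₀
    continuousAt_multiplier ode, mem_nhdsWithin_of_mem_nhds (graph.eventually hB.ker),
    self_mem_nhdsWithin] with t hzero hker ht
  rw [hB.mem_iff ht₀, hzero, hker ht]

variable {Ψ : ℝ → E → E}

lemma IsGrayField.norm_eq (hY : IsGrayField D Y) (hΨ : SmoothFlow.IsEvolution Y Ψ) (t : ℝ)
    (x : E) : ‖Ψ t x‖ = ‖x‖ := by
  have deriv_norm_sq (s : ℝ) : HasDerivAt (fun s => ‖Ψ s x‖ ^ 2) 0 s := by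
    simpa [hY.inner_eq_zero (s, Ψ s x)] using (hΨ.hasDerivAt x s).norm_sq
  have := is_const_of_deriv_eq_zero (fun s => (deriv_norm_sq s).differentiableAt)
    (fun s => (deriv_norm_sq s).deriv) t 0
  rw [hΨ.map_zero] at this
  exact (pow_left_inj₀ (norm_nonneg _) (norm_nonneg _) two_ne_zero).1 this

theorem IsGrayField.mem_iff_fderiv_mem (hY : IsGrayField D Y) (hD : IsConicContact D)
    (hΨ : SmoothFlow.IsEvolution Y Ψ) (hsmooth : ContDiff ℝ ∞ (fun q : ℝ × E => Ψ q.1 q.2))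
    {x : E} (hx : ‖x‖ = 1) {t : ℝ} (ht : t ∈ Icc (0 : ℝ) 1) (v : E) :
    v ∈ D (0, x) ↔ fderiv ℝ (Ψ t) x v ∈ D (t, Ψ t x) := by
  have key := isPreconnected_Icc.induction₂
    (fun s t => fderiv ℝ (Ψ s) x v ∈ D (s, Ψ s x) ↔ fderiv ℝ (Ψ t) x v ∈ D (t, Ψ t x))
    (fun s hs => hY.eventually_mem_iff hD (hΨ.hasDerivAt x)
      (hΨ.hasDerivAt_fderiv (hY.contDiff.differentiable (by simp))
        (hsmooth.of_le (WithTop.coe_le_coe.2 le_top)) x v)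
      (fun t => (hY.norm_eq hΨ t x).trans hx) hs)
    (fun _ _ _ _ _ _ => Iff.trans) (fun _ _ _ _ => Iff.symm) unitInterval.zero_mem ht
  rwa [show Ψ 0 = id from funext hΨ.map_zero, fderiv_id, ContinuousLinearMap.id_apply] at key

theorem IsGrayField.comm [FiniteDimensional ℝ E] (hY : IsGrayField D Y) (hD : IsConicContact D)
    (hΨ : SmoothFlow.IsEvolution Y Ψ) {U : E → E} (hU : IsSymmetry D U) {x : E} (hx : ‖x‖ = 1)
    {t : ℝ} (ht : t ∈ Icc (0 : ℝ) 1) : Ψ t (U x) = U (Ψ t x) := by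
  obtain ⟨K, hK⟩ := hY.contDiff.lipschitzWith_of_hasCompactSupport hY.hasCompactSupport (by simp)
  have hnorm (t : ℝ) : ‖Ψ t x‖ = 1 := (hY.norm_eq hΨ t x).trans hx
  have hne (t : ℝ) : Ψ t x ≠ 0 := ne_zero_of_norm_ne_zero (by simp [hnorm])
  have deriv_image (t : ℝ) :
      HasDerivAt (fun t => U (Ψ t x)) (fderiv ℝ U (Ψ t x) (Y (t, Ψ t x))) t :=
    (hU.hasFDerivAt (hne t)).comp_hasDerivAt t (hΨ.hasDerivAt x t)
  have invariant (t : ℝ) (ht : t ∈ Icc (0 : ℝ) 1) :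
      fderiv ℝ U (Ψ t x) (Y (t, Ψ t x)) = Y (t, U (Ψ t x)) :=
    hD.eq_of_isGrayVector (p := (t, U (Ψ t x))) ht (hU.ne_zero (hne t))
      (hU.isGrayVector hD (p := (t, Ψ t x)) ht (hne t)
        (hY.isGrayVector _ (mk_mem_shell ht (hnorm t))))
      (hY.isGrayVector _ (mk_mem_shell ht ((hU.norm_eq _ (hne t)).trans (hnorm t))))
  refine ODE_solution_unique (v := fun t z => Y (t, z)) (f := fun t => Ψ t (U x))
    (fun t => hK.comp (LipschitzWith.prodMk_left t))
    (fun t _ => (hΨ.hasDerivAt (U x) t).continuousAt.continuousWithinAt)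
    (fun t _ => (hΨ.hasDerivAt (U x) t).hasDerivWithinAt)
    (fun t _ => (deriv_image t).continuousAt.continuousWithinAt)
    (fun t ht => ?_) (by simp only [hΨ.map_zero]) ht
  rw [← invariant t (Ico_subset_Icc_self ht)]
  exact (deriv_image t).hasDerivWithinAt

end Transport

end ConicGray

/-! ### Radial projection and restriction to the unit sphere -/

namespace UnitSphere

variable {E : Type u} [NormedAddCommGroup E] [InnerProductSpace ℝ E]

open scoped Classical in
/-- The radial projection `y ↦ y / ‖y‖` of `E \ 0` onto the unit sphere, with an arbitrary value
at `0`. -/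
noncomputable def radialProj [Nontrivial E] (y : E) : Metric.sphere (0 : E) 1 :=
  if h : y = 0 then ⟨_, (NormedSpace.sphere_nonempty.2 zero_le_one).some_mem⟩
  else ⟨‖y‖⁻¹ • y, by simp [norm_smul, h]⟩

/-- The self-map of the unit sphere induced by a norm-preserving self-map of `E`. -/
def restrict (f : E → E) (hf : ∀ y, ‖f y‖ = ‖y‖) (x : Metric.sphere (0 : E) 1) :
    Metric.sphere (0 : E) 1 :=
  ⟨f x, by simp [hf]⟩

section RadialProjection

variable [Nontrivial E]

lemma coe_radialProj {y : E} (hy : y ≠ 0) : (radialProj y : E) = ‖y‖⁻¹ • y := by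
  simp [radialProj, hy]

lemma norm_smul_radialProj {y : E} (hy : y ≠ 0) : ‖y‖ • (radialProj y : E) = y := by
  rw [coe_radialProj hy, smul_inv_smul₀ (norm_ne_zero_iff.2 hy)]

@[simp] lemma radialProj_coe (x : Metric.sphere (0 : E) 1) : radialProj (x : E) = x := by
  ext1
  simp [coe_radialProj (ne_zero_of_mem_unit_sphere x)]

lemma radialProj_smul {c : ℝ} (hc : 0 < c) (y : E) : radialProj (c • y) = radialProj y := by
  by_cases hy : y = 0
  · simp [hy]
  · ext1
    rw [coe_radialProj hy, coe_radialProj (smul_ne_zero hc.ne' hy), norm_smul, smul_smul,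
      Real.norm_of_nonneg hc.le, mul_inv, mul_right_comm, inv_mul_cancel₀ hc.ne', one_mul]

end RadialProjection

lemma contDiffAt_normalize {y : E} (hy : y ≠ 0) : ContDiffAt ℝ ∞ (fun z : E => ‖z‖⁻¹ • z) y :=
  ((contDiffAt_norm ℝ hy).inv (norm_ne_zero_iff.2 hy)).smul contDiffAt_id

lemma hasFDerivAt_norm {y : E} (hy : y ≠ 0) :
    HasFDerivAt (fun z : E => ‖z‖) (‖y‖⁻¹ • innerSL ℝ y) y := by
  have hn : ‖y‖ ≠ 0 := norm_ne_zero_iff.2 hy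
  have := ((hasFDerivAt_id (𝕜 := ℝ) y).norm_sq).sqrt (by simpa using hn)
  simp only [id, Real.sqrt_sq (norm_nonneg _)] at this
  refine this.congr_fderiv ?_
  ext w
  simp only [one_div, mul_inv_rev, ContinuousLinearMap.comp_id, smul_apply, coe_innerSL_apply,
    nsmul_eq_mul, Nat.cast_ofNat, smul_eq_mul]
  field_simp

lemma fderiv_normalize_apply {y : E} (hy : y ≠ 0) (X : E) :
    fderiv ℝ (fun z : E => ‖z‖⁻¹ • z) y X = ‖y‖⁻¹ • X - (‖y‖⁻¹ ^ 3 * ⟪y, X⟫) • y := by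
  have deriv_inv :=
    (hasDerivAt_inv (norm_ne_zero_iff.2 hy)).comp_hasFDerivAt y (hasFDerivAt_norm hy)
  have deriv_normalize : HasFDerivAt (fun z : E => ‖z‖⁻¹ • z) _ y :=
    deriv_inv.smul (hasFDerivAt_id y)
  rw [deriv_normalize.fderiv]
  simp only [Function.comp_apply, neg_smul, add_apply, smul_apply, ContinuousLinearMap.id_apply,
    ContinuousLinearMap.smulRight_apply, neg_apply, coe_innerSL_apply, smul_eq_mul, inv_pow,
    sub_eq_add_neg, add_right_inj, neg_inj]
  field_simp

section Smooth

variable {n : ℕ} [Fact (Module.finrank ℝ E = n + 1)]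

lemma inner_mvfderiv_coe (x : Metric.sphere (0 : E) 1) (v : TangentSpace (𝓡 n) x) :
    ⟪(x : E), mvfderiv (𝓡 n) (Subtype.val : Metric.sphere (0 : E) 1 → E) x v⟫ = 0 := by
  rw [← Submodule.mem_orthogonal_singleton_iff_inner_right, ← range_mvfderiv_subtypeVal (n := n)]
  exact ⟨v, rfl⟩

lemma mdifferentiableAt_coe (x : Metric.sphere (0 : E) 1) :
    MDifferentiableAt (𝓡 n) 𝓘(ℝ, E) (Subtype.val : Metric.sphere (0 : E) 1 → E) x :=
  contMDiff_coe_sphere.mdifferentiableAt one_ne_zero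

section RadialProjection

variable [Nontrivial E] {y : E}

lemma contMDiffAt_radialProj (hy : y ≠ 0) : ContMDiffAt 𝓘(ℝ, E) (𝓡 n) ∞ radialProj y := by
  let O : TopologicalSpace.Opens E := ⟨{0}ᶜ, isOpen_compl_singleton⟩
  have hne (z : O) : (z : E) ≠ 0 := z.2
  have smooth_normalize : ContMDiff 𝓘(ℝ, E) 𝓘(ℝ, E) ∞ (fun z : O => ‖(z : E)‖⁻¹ • (z : E)) :=
    fun z => (contDiffAt_normalize (hne z)).contMDiffAt.comp z contMDiff_subtype_val.contMDiffAt
  have smooth_codRestrict := smooth_normalize.codRestrict_sphere (n := n)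
    fun z => by simp [norm_smul, hne z]
  have smooth_restrict : ContMDiffAt 𝓘(ℝ, E) (𝓡 n) ∞ (fun z : O => radialProj (z : E)) ⟨y, hy⟩ :=
    (smooth_codRestrict ⟨y, hy⟩).congr_of_eventuallyEq
      (.of_forall fun z => Subtype.ext (coe_radialProj (hne z)))
  exact contMDiffAt_subtype_iff.1 smooth_restrict

lemma contMDiffOn_radialProj : ContMDiffOn 𝓘(ℝ, E) (𝓡 n) ∞ (radialProj (E := E)) {0}ᶜ :=
  fun _ hy => (contMDiffAt_radialProj hy).contMDiffWithinAt

lemma mdifferentiableAt_radialProj (hy : y ≠ 0) :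
    MDifferentiableAt 𝓘(ℝ, E) (𝓡 n) radialProj y :=
  (contMDiffAt_radialProj hy).mdifferentiableAt (by simp)

lemma mvfderiv_coe_mfderiv_radialProj (hy : y ≠ 0) (X : E) :
    mvfderiv (𝓡 n) (Subtype.val : Metric.sphere (0 : E) 1 → E) (radialProj y)
        (mfderiv 𝓘(ℝ, E) (𝓡 n) radialProj y X) =
      ‖y‖⁻¹ • X - (‖y‖⁻¹ ^ 3 * ⟪y, X⟫) • y := by
  have chain := mfderiv_comp_apply y (mdifferentiableAt_coe (n := n) (radialProj y))
    (mdifferentiableAt_radialProj hy) X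
  have coe_comp : Subtype.val ∘ radialProj =ᶠ[𝓝 y] fun z : E => ‖z‖⁻¹ • z := by
    filter_upwards [eventually_ne_nhds hy] with z hz using coe_radialProj hz
  rw [← fderiv_normalize_apply hy, ← coe_comp.fderiv_eq, ← mfderiv_eq_fderiv]
  exact chain.symm

lemma mfderiv_radialProj_self (hy : y ≠ 0) : mfderiv 𝓘(ℝ, E) (𝓡 n) radialProj y y = 0 := by
  have hn : ‖y‖ ≠ 0 := norm_ne_zero_iff.2 hy
  have cancel : ‖y‖⁻¹ ^ 3 * ‖y‖ ^ 2 = ‖y‖⁻¹ := by field_simp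
  refine injective_mvfderiv_subtypeVal_sphere _ ?_
  rw [mvfderiv_coe_mfderiv_radialProj hy y, real_inner_self_eq_norm_sq, cancel, sub_self, map_zero]

lemma surjective_mfderiv_radialProj (hy : y ≠ 0) :
    Function.Surjective (mfderiv 𝓘(ℝ, E) (𝓡 n) radialProj y) := fun v => by
  let w := mvfderiv (𝓡 n) (Subtype.val : Metric.sphere (0 : E) 1 → E) (radialProj y) v
  have horth : ⟪y, w⟫ = 0 := by
    rw [← norm_smul_radialProj hy, real_inner_smul_left, inner_mvfderiv_coe, mul_zero]
  refine ⟨‖y‖ • w, injective_mvfderiv_subtypeVal_sphere _ ?_⟩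
  refine (mvfderiv_coe_mfderiv_radialProj hy _).trans ?_
  rw [inner_smul_right, horth, inv_smul_smul₀ (norm_ne_zero_iff.2 hy)]
  simp [w]

lemma eq_zero_of_mfderiv_radialProj_eq_zero (hy : y ≠ 0) {X : E} (horth : ⟪y, X⟫ = 0)
    (h : mfderiv 𝓘(ℝ, E) (𝓡 n) radialProj y X = 0) : X = 0 := by
  have := mvfderiv_coe_mfderiv_radialProj (n := n) hy X
  rw [h, map_zero, horth, mul_zero, zero_smul, sub_zero] at this
  exact (smul_eq_zero.1 this.symm).resolve_left (inv_ne_zero (norm_ne_zero_iff.2 hy))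

end RadialProjection

section Restrict

lemma contMDiff_restrict {m : ℕ∞ω} {f : E → E} (hf : ∀ y, ‖f y‖ = ‖y‖) (hs : ContDiff ℝ m f) :
    ContMDiff (𝓡 n) (𝓡 n) m (restrict f hf) :=
  (hs.contMDiff.comp contMDiff_coe_sphere).codRestrict_sphere fun x => by simp [hf]

lemma contMDiff_uncurry_restrict {m : ℕ∞ω} {Ψ : ℝ → E → E} (hΨ : ∀ t y, ‖Ψ t y‖ = ‖y‖)
    (hs : ContDiff ℝ m fun q : ℝ × E => Ψ q.1 q.2) :
    ContMDiff (𝓘(ℝ, ℝ).prod (𝓡 n)) (𝓡 n) m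
      (fun p : ℝ × Metric.sphere (0 : E) 1 => restrict (Ψ p.1) (hΨ p.1) p.2) :=
  (hs.contMDiff.comp (contMDiff_fst.prodMk_space
    (contMDiff_coe_sphere.comp contMDiff_snd))).codRestrict_sphere fun p => by simp [hΨ]

lemma exists_diffeomorph_eq_restrict {m : ℕ∞ω} {f : E → E} (hf : ∀ y, ‖f y‖ = ‖y‖)
    (hdiffeo : ∃ Φ : E ≃ₘ^m⟮𝓘(ℝ, E), 𝓘(ℝ, E)⟯ E, ⇑Φ = f) :
    ∃ φ : Metric.sphere (0 : E) 1 ≃ₘ^m⟮𝓡 n, 𝓡 n⟯ Metric.sphere (0 : E) 1, ⇑φ = restrict f hf := by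
  obtain ⟨Φ, rfl⟩ := hdiffeo
  have norm_symm (y : E) : ‖Φ.symm y‖ = ‖y‖ := by rw [← hf, Φ.apply_symm_apply]
  exact ⟨{ toFun := restrict Φ hf
           invFun := restrict Φ.symm norm_symm
           left_inv := fun x => Subtype.ext (Φ.symm_apply_apply x)
           right_inv := fun x => Subtype.ext (Φ.apply_symm_apply x)
           contMDiff_toFun := contMDiff_restrict hf Φ.contMDiff.contDiff
           contMDiff_invFun := contMDiff_restrict norm_symm Φ.symm.contMDiff.contDiff }, rfl⟩

lemma mvfderiv_coe_mfderiv_restrict {m : ℕ∞ω} {f : E → E} (hf : ∀ y, ‖f y‖ = ‖y‖)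
    (hs : ContDiff ℝ m f) (hm : m ≠ 0) (x : Metric.sphere (0 : E) 1) (v : TangentSpace (𝓡 n) x) :
    mvfderiv (𝓡 n) (Subtype.val : Metric.sphere (0 : E) 1 → E) (restrict f hf x)
        (mfderiv (𝓡 n) (𝓡 n) (restrict f hf) x v) =
      fderiv ℝ f x (mvfderiv (𝓡 n) (Subtype.val : Metric.sphere (0 : E) 1 → E) x v) := by
  have chain_coe := mfderiv_comp_apply x (mdifferentiableAt_coe (n := n) (restrict f hf x))
    ((contMDiff_restrict hf hs).mdifferentiableAt hm) v
  have chain := mfderiv_comp_apply (I' := 𝓘(ℝ, E)) (g := f) x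
    (hs.differentiable hm (x : E)).mdifferentiableAt (mdifferentiableAt_coe (n := n) x) v
  rw [mfderiv_eq_fderiv] at chain
  exact chain_coe.symm.trans chain

end Restrict

end Smooth

end UnitSphere

/-! ### Pullbacks of distributions and forms on the three-sphere -/

namespace InvContact

section PullDistribution

variable {F H M : Type*} [NormedAddCommGroup F] [NormedSpace ℝ F] [TopologicalSpace H]
  {I : ModelWithCorners ℝ F H} [TopologicalSpace M] [ChartedSpace H M]
  {F' H' M' : Type*} [NormedAddCommGroup F'] [NormedSpace ℝ F'] [TopologicalSpace H']
  {I' : ModelWithCorners ℝ F' H'} [TopologicalSpace M'] [ChartedSpace H' M']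

variable (I) in
/-- The preimage of a distribution on `S³` under the differential of a map `h : M → S³`. -/
noncomputable def Distribution.pull (η : Distribution) (h : M → S3) (y : M) :
    Submodule ℝ (TangentSpace I y) :=
  (η (h y)).comap (mfderiv I (𝓡 3) h y).toLinearMap

lemma Distribution.mem_pull {η : Distribution} {h : M → S3} {y : M} {w : TangentSpace I y} :
    w ∈ η.pull I h y ↔ mfderiv I (𝓡 3) h y w ∈ η (h y) := Iff.rfl

lemma Distribution.pull_congr (η : Distribution) {h h' : M → S3} {y : M} (hh : h =ᶠ[𝓝 y] h') :
    η.pull I h y = η.pull I h' y := by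
  -- All `T_x S³` are definitionally `ℝ³`; on this common type `h y` can be replaced by `h' y`.
  let η' : S3 → Submodule ℝ (EuclideanSpace ℝ (Fin 3)) := η
  have deriv_eq : (mfderiv I (𝓡 3) h y : TangentSpace I y →L[ℝ] EuclideanSpace ℝ (Fin 3)) =
      mfderiv I (𝓡 3) h' y := hh.mfderiv_eq
  change (η' (h y)).comap (ContinuousLinearMap.toLinearMap (mfderiv I (𝓡 3) h y :
      TangentSpace I y →L[ℝ] EuclideanSpace ℝ (Fin 3))) = _
  rw [deriv_eq, hh.self_of_nhds]
  rfl

lemma Distribution.mem_pull_comp (η : Distribution) {h : M' → S3} {f : M → M'} {y : M}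
    (hh : MDifferentiableAt I' (𝓡 3) h (f y)) (hf : MDifferentiableAt I I' f y)
    (w : TangentSpace I y) :
    w ∈ η.pull I (h ∘ f) y ↔ mfderiv I I' f y w ∈ η.pull I' h (f y) := by
  rw [mem_pull, mem_pull, mfderiv_comp_apply y hh hf]
  rfl

lemma Distribution.mem_pull_id (η : Distribution) (x : S3) (v : TS x) :
    v ∈ η.pull (𝓡 3) id x ↔ v ∈ η x := by
  rw [mem_pull, mfderiv_id]
  rfl

end PullDistribution

section PullForm

variable {V : Type*} [NormedAddCommGroup V] [NormedSpace ℝ V]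

/-- The pullback of a `1`-form on `S³` to a vector space. -/
noncomputable def OneForm.pull (γ : OneForm) (h : V → S3) (y : V) : V →L[ℝ] ℝ :=
  (γ (h y)).comp (mfderiv 𝓘(ℝ, V) (𝓡 3) h y)

lemma OneForm.pull_congr (γ : OneForm) {h h' : V → S3} {y : V} (hh : h =ᶠ[𝓝 y] h') :
    γ.pull h y = γ.pull h' y := by
  let γ' : S3 → EuclideanSpace ℝ (Fin 3) →L[ℝ] ℝ := γ
  have deriv_eq : (mfderiv 𝓘(ℝ, V) (𝓡 3) h y : V →L[ℝ] EuclideanSpace ℝ (Fin 3)) =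
      mfderiv 𝓘(ℝ, V) (𝓡 3) h' y := hh.mfderiv_eq
  change (γ' (h y)).comp (mfderiv 𝓘(ℝ, V) (𝓡 3) h y : V →L[ℝ] EuclideanSpace ℝ (Fin 3)) = _
  rw [deriv_eq, hh.self_of_nhds]
  rfl

lemma OneForm.pull_comp {V' : Type*} [NormedAddCommGroup V'] [NormedSpace ℝ V'] (γ : OneForm)
    {h : V' → S3} {f : V → V'} {y : V} (hh : MDifferentiableAt 𝓘(ℝ, V') (𝓡 3) h (f y))
    (hf : DifferentiableAt ℝ f y) :
    γ.pull (h ∘ f) y = (γ.pull h (f y)).comp (fderiv ℝ f y) := by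
  ext w
  have chain := mfderiv_comp_apply y hh hf.mdifferentiableAt w
  rw [mfderiv_eq_fderiv] at chain
  exact congrArg (γ (h (f y))) chain

variable [FiniteDimensional ℝ V] {h : V → S3} {s : Set V}

lemma OneForm.contDiffAt_pull {β : ℝ → OneForm} {U : Set (ℝ × S3)} (hU : IsOpen U)
    (hβ : ContMDiffOn (𝓘(ℝ, ℝ).prod (𝓡 3).tangent) 𝓘(ℝ, ℝ) ∞
      (fun p : ℝ × TangentBundle (𝓡 3) S3 => β p.1 p.2.1 p.2.2) {p | (p.1, p.2.1) ∈ U})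
    (hs : IsOpen s) (hh : ContMDiffOn 𝓘(ℝ, V) (𝓡 3) ∞ h s) {q : ℝ × V} (hq : q.2 ∈ s)
    (hqU : (q.1, h q.2) ∈ U) :
    ContDiffAt ℝ ∞ (fun q : ℝ × V => (β q.1).pull h q.2) q := by
  refine ConicGray.contDiffAt_clm_apply_iff.2 fun w => ?_
  let dh (y : V) : TangentBundle (𝓡 3) S3 := tangentMapWithin 𝓘(ℝ, V) (𝓡 3) h s ⟨y, w⟩
  have isOpen_domain : IsOpen {p : ℝ × TangentBundle (𝓡 3) S3 | (p.1, p.2.1) ∈ U} :=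
    hU.preimage (continuous_fst.prodMk ((FiberBundle.continuous_proj _ _).comp continuous_snd))
  have smooth_const : ContMDiff 𝓘(ℝ, V) 𝓘(ℝ, V).tangent ∞
      (fun y : V => (⟨y, w⟩ : TangentBundle 𝓘(ℝ, V) V)) :=
    contMDiff_vectorSpace_iff_contDiff.2 contDiff_const
  have smooth_dh : ContMDiffAt 𝓘(ℝ, V) (𝓡 3).tangent ∞ dh q.2 :=
    ((hh.contMDiffOn_tangentMapWithin (m := ∞) (by simp) hs.uniqueMDiffOn).comp
      (smooth_const.contMDiffOn (s := s)) fun _ hy => hy).contMDiffAt (hs.mem_nhds hq)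
  have smooth_eval : ContMDiffAt 𝓘(ℝ, ℝ × V) 𝓘(ℝ, ℝ) ∞
      (fun q : ℝ × V => β q.1 (dh q.2).1 (dh q.2).2) q :=
    (hβ.contMDiffAt (isOpen_domain.mem_nhds (x := (q.1, dh q.2)) hqU)).comp q
      (contDiffAt_fst.contMDiffAt.prodMk (smooth_dh.comp q contDiffAt_snd.contMDiffAt))
  refine smooth_eval.contDiffAt.congr_of_eventuallyEq ?_
  filter_upwards [continuousAt_snd.eventually (hs.mem_nhds hq)] with q' hq'
  change _ = β q'.1 (h q'.2) (mfderivWithin 𝓘(ℝ, V) (𝓡 3) h s q'.2 w)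
  rw [mfderivWithin_of_isOpen hs hq']
  rfl

lemma OneForm.Smooth.contDiffAt_pull {γ : OneForm} (hγ : γ.Smooth) (hs : IsOpen s)
    (hh : ContMDiffOn 𝓘(ℝ, V) (𝓡 3) ∞ h s) {y : V} (hy : y ∈ s) :
    ContDiffAt ℝ ∞ (γ.pull h) y := by
  have smooth_const := OneForm.contDiffAt_pull (β := fun _ => γ) (U := univ) isOpen_univ
    (hγ.comp contMDiff_snd).contMDiffOn hs hh (q := ((0 : ℝ), y)) hy (mem_univ _)
  exact smooth_const.comp (f := fun z => ((0 : ℝ), z)) y (contDiffAt_const.prodMk contDiffAt_id)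

end PullForm

section ExteriorDerivative

variable {V : Type*} [NormedAddCommGroup V] [NormedSpace ℝ V]

/-- The second derivatives of `f` cancel by symmetry: pullback commutes with the exterior
derivative. -/
lemma fderiv_pullback_sub {V' : Type*} [NormedAddCommGroup V'] [NormedSpace ℝ V']
    {a : V' → V' →L[ℝ] ℝ} {f : V → V'} {y : V} {A : V → V →L[ℝ] ℝ}
    (ha : DifferentiableAt ℝ a (f y)) (hf : ContDiffAt ℝ 2 f y)
    (hA : A =ᶠ[𝓝 y] fun z => (a (f z)).comp (fderiv ℝ f z)) (v w : V) :
    fderiv ℝ A y v w - fderiv ℝ A y w v =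
      fderiv ℝ a (f y) (fderiv ℝ f y v) (fderiv ℝ f y w) -
        fderiv ℝ a (f y) (fderiv ℝ f y w) (fderiv ℝ f y v) := by
  have deriv_f : HasFDerivAt f (fderiv ℝ f y) y := (hf.differentiableAt two_ne_zero).hasFDerivAt
  have deriv_fderiv : HasFDerivAt (fderiv ℝ f) (fderiv ℝ (fderiv ℝ f) y) y :=
    ((hf.fderiv_right (m := 1) (by norm_num)).differentiableAt one_ne_zero).hasFDerivAt
  have deriv_A := ((HasFDerivAt.comp y ha.hasFDerivAt deriv_f).clm_comp
    deriv_fderiv).congr_of_eventuallyEq hA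
  have symmetric : IsSymmSndFDerivAt ℝ f y := hf.isSymmSndFDerivAt (by simp)
  rw [deriv_A.fderiv]
  simp [symmetric.eq v w]

variable {γ : OneForm}

lemma OneForm.pull_eventuallyEq_extChartAt (γ : OneForm) (x : S3) {h : V → S3} {y : V}
    (hh : ∀ᶠ z in 𝓝 y, MDifferentiableAt 𝓘(ℝ, V) (𝓡 3) h z)
    (hy : h y ∈ (extChartAt (𝓡 3) x).source) :
    γ.pull h =ᶠ[𝓝 y] fun z => (γ.pull (extChartAt (𝓡 3) x).symm (extChartAt (𝓡 3) x (h z))).comp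
      (fderiv ℝ (extChartAt (𝓡 3) x ∘ h) z) := by
  set φ := extChartAt (𝓡 3) x
  have mem_source : ∀ᶠ z in 𝓝 y, h z ∈ φ.source :=
    hh.self_of_nhds.continuousAt.eventually ((isOpen_extChartAt_source x).mem_nhds hy)
  filter_upwards [eventually_eventually_nhds.2 mem_source, hh] with z hz hhz
  have left_inv : h =ᶠ[𝓝 z] φ.symm ∘ (φ ∘ h) := by
    filter_upwards [hz] with z' hz' using (φ.left_inv hz').symm
  have chart_mdiff : MDifferentiableAt (𝓡 3) 𝓘(ℝ, EuclideanSpace ℝ (Fin 3)) φ (h z) :=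
    mdifferentiableAt_extChartAt (by rw [← extChartAt_source (𝓡 3)]; exact hz.self_of_nhds)
  have symm_mdiff : MDifferentiableAt 𝓘(ℝ, EuclideanSpace ℝ (Fin 3)) (𝓡 3) φ.symm (φ (h z)) :=
    ((contMDiffOn_extChartAt_symm x).contMDiffAt ((isOpen_extChartAt_target x).mem_nhds
      (φ.map_source hz.self_of_nhds))).mdifferentiableAt one_ne_zero
  rw [γ.pull_congr left_inv]
  exact γ.pull_comp symm_mdiff (chart_mdiff.comp z hhz).differentiableAt

lemma OneForm.Smooth.d_mfderiv (hγ : γ.Smooth) {h : V → S3} {s : Set V} (hs : IsOpen s)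
    (hh : ContMDiffOn 𝓘(ℝ, V) (𝓡 3) ∞ h s) {y : V} (hy : y ∈ s) (v w : V) :
    γ.d (h y) (mfderiv 𝓘(ℝ, V) (𝓡 3) h y v) (mfderiv 𝓘(ℝ, V) (𝓡 3) h y w) =
      fderiv ℝ (γ.pull h) y v w - fderiv ℝ (γ.pull h) y w v := by
  let φ := extChartAt (𝓡 3) (h y)
  have hh' (z : V) (hz : z ∈ s) : ContMDiffAt 𝓘(ℝ, V) (𝓡 3) ∞ h z := hh.contMDiffAt (hs.mem_nhds hz)
  have hφ : ContMDiffAt (𝓡 3) 𝓘(ℝ, EuclideanSpace ℝ (Fin 3)) ∞ φ (h y) := contMDiffAt_extChartAt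
  have hφh : ContDiffAt ℝ ∞ (φ ∘ h) y := (hφ.comp y (hh' y hy)).contDiffAt
  have mdiff : ∀ᶠ z in 𝓝 y, MDifferentiableAt 𝓘(ℝ, V) (𝓡 3) h z := by
    filter_upwards [hs.mem_nhds hy] with z hz using (hh' z hz).mdifferentiableAt (by simp)
  have diff_chart : DifferentiableAt ℝ (γ.pull φ.symm) (φ (h y)) :=
    (hγ.contDiffAt_pull (isOpen_extChartAt_target (h y)) (contMDiffOn_extChartAt_symm (h y))
      (φ.map_source (mem_extChartAt_source (h y)))).differentiableAt (by simp)
  have fderiv_chart (v : V) : fderiv ℝ (φ ∘ h) y v =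
      mvfderiv (𝓡 3) φ (h y) (mfderiv 𝓘(ℝ, V) (𝓡 3) h y v) := by
    have chain := mfderiv_comp_apply y (hφ.mdifferentiableAt (by simp)) mdiff.self_of_nhds v
    rw [mfderiv_eq_fderiv] at chain
    exact chain
  rw [fderiv_pullback_sub (f := φ ∘ h) diff_chart (hφh.of_le (WithTop.coe_le_coe.2 le_top))
    (γ.pull_eventuallyEq_extChartAt (h y) mdiff (mem_extChartAt_source (h y))) v w,
    fderiv_chart v, fderiv_chart w]
  rfl

end ExteriorDerivative

end InvContact

/-! ### The cone over a family of contact structures -/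

namespace InvContact

/-- The ambient space `ℝ⁴` of `S³`. -/
abbrev E4 : Type := EuclideanSpace ℝ (Fin 4)

lemma fact_finrank_E4 : Fact (Module.finrank ℝ E4 = 3 + 1) := ⟨finrank_euclideanSpace_fin⟩

attribute [local instance] fact_finrank_E4

open UnitSphere

section ContactForm

lemma finrank_TS (x : S3) : Module.finrank ℝ (TS x) = 3 :=
  (finrank_euclideanSpace_fin : Module.finrank ℝ (EuclideanSpace ℝ (Fin 3)) = 3)

instance (x : S3) : FiniteDimensional ℝ (TS x) :=
  inferInstanceAs (FiniteDimensional ℝ (EuclideanSpace ℝ (Fin 3)))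

lemma linearIndependent_cons_dIncl {x : S3} {v : Fin 3 → TS x} (hv : LinearIndependent ℝ v) :
    LinearIndependent ℝ (Fin.cons (x : E4) fun i => dIncl x (v i) : Fin 4 → E4) := by
  rw [linearIndependent_finCons]
  refine ⟨hv.map' (dIncl x).toLinearMap
    (LinearMap.ker_eq_bot.2 (injective_mvfderiv_subtypeVal_sphere x)), fun hmem => ?_⟩
  have span_le : Submodule.span ℝ (range fun i => dIncl x (v i)) ≤ (ℝ ∙ (x : E4))ᗮ := by
    rw [Submodule.span_le]
    rintro _ ⟨i, rfl⟩
    exact Submodule.mem_orthogonal_singleton_iff_inner_right.2 (inner_mvfderiv_coe x (v i))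
  exact ne_zero_of_mem_unit_sphere x
    (inner_self_eq_zero.1 (Submodule.mem_orthogonal_singleton_iff_inner_right.1 (span_le hmem)))

lemma posOriented_or_swap {x : S3} {v : Fin 3 → TS x} (hv : LinearIndependent ℝ v) :
    PosOriented x (v 0) (v 1) (v 2) ∨ PosOriented x (v 1) (v 0) (v 2) := by
  let N : Matrix (Fin 4) (Fin 4) ℝ := Matrix.of fun i j =>
    ![(x : E4), dIncl x (v 0), dIncl x (v 1), dIncl x (v 2)] i j
  have cons_eq : (Fin.cons (x : E4) fun i => dIncl x (v i) : Fin 4 → E4) =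
      ![(x : E4), dIncl x (v 0), dIncl x (v 1), dIncl x (v 2)] := by
    funext i
    fin_cases i <;> rfl
  have rows_independent : LinearIndependent ℝ N.row :=
    (cons_eq ▸ linearIndependent_cons_dIncl hv).map'
      (WithLp.linearEquiv 2 ℝ (Fin 4 → ℝ)).toLinearMap (LinearEquiv.ker _)
  have det_ne_zero : N.det ≠ 0 := ((Matrix.isUnit_iff_isUnit_det _).1
    (Matrix.linearIndependent_rows_iff_isUnit.1 rows_independent)).ne_zero
  have swap_rows : Matrix.of (fun i j : Fin 4 =>
      ![(x : E4), dIncl x (v 1), dIncl x (v 0), dIncl x (v 2)] i j) =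
      N.submatrix (Equiv.swap 1 2) id := by
    ext i j
    fin_cases i <;> rfl
  rcases det_ne_zero.lt_or_gt with h | h
  · right
    rw [PosOriented, swap_rows, Matrix.det_permute, Equiv.Perm.sign_swap (by decide)]
    simpa using h
  · exact .inl h

lemma OneForm.d_swap (α : OneForm) (x : S3) (v w : TS x) : α.d x v w = -α.d x w v := by
  simp [OneForm.d]

namespace OneForm.IsContact

variable {α : OneForm} {x : S3}

lemma wedgeD_ne_zero (hα : α.IsContact) {v : Fin 3 → TS x} (hv : LinearIndependent ℝ v) :
    α.wedgeD x (v 0) (v 1) (v 2) ≠ 0 := by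
  rcases posOriented_or_swap hv with h | h
  · exact (hα.pos x _ _ _ h).ne'
  · have swap : α.wedgeD x (v 1) (v 0) (v 2) = -α.wedgeD x (v 0) (v 1) (v 2) := by
      rw [wedgeD, wedgeD, α.d_swap x (v 0) (v 2), α.d_swap x (v 2) (v 1), α.d_swap x (v 1) (v 0)]
      ring
    have := hα.pos x _ _ _ h
    rw [swap] at this
    exact (neg_pos.1 this).ne

lemma exists_apply_ne_zero (hα : α.IsContact) (x : S3) : ∃ v : TS x, α x v ≠ 0 := by
  by_contra! h
  exact hα.wedgeD_ne_zero (Module.finBasisOfFinrankEq ℝ (TS x) (finrank_TS x)).linearIndependent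
    (by simp [wedgeD, h])

lemma finrank_kernel (hα : α.IsContact) (x : S3) : Module.finrank ℝ (α.kernel x) = 2 := by
  obtain ⟨v, hv⟩ := hα.exists_apply_ne_zero x
  have rank_nullity := Module.Dual.finrank_ker_add_one_of_ne_zero (f := (α x).toLinearMap)
    fun h => hv (LinearMap.congr_fun h v)
  rw [finrank_TS] at rank_nullity
  exact Nat.succ_injective rank_nullity

lemma nondegenerate (hα : α.IsContact) {X : TS x} (hX : α x X = 0)
    (h : ∀ w, α x w = 0 → α.d x X w = 0) : X = 0 := by
  by_contra hX0
  obtain ⟨z, hz⟩ := hα.exists_apply_ne_zero x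
  obtain ⟨w, hw, hwX⟩ : ∃ w ∈ α.kernel x, w ∉ Submodule.span ℝ {X} := by
    by_contra! hc
    have := Submodule.finrank_mono (show α.kernel x ≤ Submodule.span ℝ {X} from hc)
    rw [hα.finrank_kernel, finrank_span_singleton hX0] at this
    exact absurd this (by norm_num)
  have independent : LinearIndependent ℝ ![z, X, w] := by
    refine linearIndependent_finCons.2 ⟨(LinearIndependent.pair_iff' hX0).2 fun a ha =>
      hwX (Submodule.mem_span_singleton.2 ⟨a, ha⟩), fun hmem => hz ?_⟩
    have span_le : Submodule.span ℝ (range ![X, w]) ≤ α.kernel x := by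
      rw [Submodule.span_le, Matrix.range_cons_cons_empty, insert_subset_iff]
      exact ⟨hX, singleton_subset_iff.2 hw⟩
    exact span_le hmem
  refine hα.wedgeD_ne_zero independent ?_
  simp [wedgeD, hX, h w hw, show α x w = 0 from hw]

end OneForm.IsContact

end ContactForm

section Cone

/-- The family of hyperplane fields on `ℝ⁴ \ 0` induced by a family of plane fields on `S³`
through the radial projection. -/
noncomputable def coneDistribution (ξ : ℝ → Distribution) (q : ℝ × E4) : Submodule ℝ E4 :=
  (ξ q.1).pull 𝓘(ℝ, E4) radialProj q.2

variable {ξ : ℝ → Distribution}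

lemma mem_coneDistribution {t : ℝ} {y w : E4} :
    w ∈ coneDistribution ξ (t, y) ↔
      mfderiv 𝓘(ℝ, E4) (𝓡 3) radialProj y w ∈ ξ t (radialProj y) := Iff.rfl

lemma dIncl_mem_coneDistribution {t : ℝ} {x : S3} {v : TS x} :
    dIncl x v ∈ coneDistribution ξ (t, (x : E4)) ↔ v ∈ ξ t x := by
  have comp_eq_id : radialProj ∘ Subtype.val = (id : S3 → S3) := funext radialProj_coe
  rw [← (ξ t).mem_pull_id x v, ← comp_eq_id]
  exact ((ξ t).mem_pull_comp (mdifferentiableAt_radialProj (ne_zero_of_mem_unit_sphere x))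
    (mdifferentiableAt_coe x) v).symm

lemma IsSmoothFamily.exists_isDefiningForm (hξ : IsSmoothFamily ξ) {t : ℝ} (ht : t ∈ Icc (0 : ℝ) 1)
    {y : E4} (hy : y ≠ 0) : ∃ B, ConicGray.IsDefiningForm (coneDistribution ξ) (t, y) B := by
  obtain ⟨U, hU, hmem, β, hβ, hker⟩ := hξ t ht (radialProj y)
  have continuousAt_proj : ContinuousAt (fun q : ℝ × E4 => (q.1, radialProj q.2)) (t, y) :=
    continuousAt_fst.prodMk (ContinuousAt.comp (g := radialProj) (f := Prod.snd)
      (contMDiffAt_radialProj (n := 3) hy).continuousAt continuousAt_snd)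
  have mem_U : ∀ᶠ q : ℝ × E4 in 𝓝 (t, y), (q.1, radialProj q.2) ∈ U :=
    continuousAt_proj.eventually (hU.mem_nhds hmem)
  have ne_zero : ∀ᶠ q : ℝ × E4 in 𝓝 (t, y), q.2 ≠ 0 :=
    (continuousAt_snd (p := (t, y))).eventually_ne hy
  refine ⟨fun q => (β q.1).pull radialProj q.2, ?_, ?_⟩
  · filter_upwards [mem_U, ne_zero] with q hq hq0
    exact OneForm.contDiffAt_pull hU hβ isOpen_compl_singleton contMDiffOn_radialProj hq0 hq
  · filter_upwards [mem_U] with q hq hqt w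
    rw [mem_coneDistribution, hker q.1 hqt _ hq]
    rfl

lemma coneDistribution_smul (t : ℝ) {y : E4} (hy : y ≠ 0) {c : ℝ} (hc : 0 < c) :
    coneDistribution ξ (t, c • y) = coneDistribution ξ (t, y) := by
  have comp_eq : radialProj ∘ (fun z : E4 => c • z) = radialProj :=
    funext fun z => radialProj_smul hc z
  have deriv_smul : HasFDerivAt (fun z : E4 => c • z) (c • ContinuousLinearMap.id ℝ E4) y :=
    (hasFDerivAt_id y).const_smul c
  ext w
  have pull_comp := (ξ t).mem_pull_comp (f := fun z : E4 => c • z) (h := radialProj) (y := y)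
    (mdifferentiableAt_radialProj (smul_ne_zero hc.ne' hy))
    deriv_smul.differentiableAt.mdifferentiableAt w
  rw [comp_eq, mfderiv_eq_fderiv, deriv_smul.fderiv] at pull_comp
  exact (Submodule.smul_mem_iff _ hc.ne').symm.trans pull_comp.symm

lemma isConicContact_coneDistribution
    (hξ : ∀ t ∈ Icc (0 : ℝ) 1, ∃ α : OneForm, α.IsContact ∧ ξ t = α.kernel)
    (hsmooth : IsSmoothFamily ξ) : ConicGray.IsConicContact (coneDistribution ξ) where
  exists_form _ ht _ hy := hsmooth.exists_isDefiningForm ht hy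
  conic t _ _ hy _ hc := coneDistribution_smul t hy hc
  radial t _ y hy := by
    rw [mem_coneDistribution, mfderiv_radialProj_self hy]
    exact zero_mem _
  exists_notMem t ht y hy := by
    obtain ⟨α, hα, hk⟩ := hξ t ht
    obtain ⟨v, hv⟩ := hα.exists_apply_ne_zero (radialProj y)
    obtain ⟨(e : E4), rfl⟩ := surjective_mfderiv_radialProj hy v
    refine ⟨e, fun h => hv ?_⟩
    rw [mem_coneDistribution, hk] at h
    exact h
  nondegenerate t ht y hy := by
    obtain ⟨α, hα, hk⟩ := hξ t ht
    refine ⟨α.pull radialProj, ?_, .of_forall fun z w => ?_, fun X hX horth hc => ?_⟩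
    · exact (hα.smooth.contDiffAt_pull isOpen_compl_singleton contMDiffOn_radialProj
        hy).differentiableAt (by simp)
    · rw [mem_coneDistribution, hk]
      rfl
    · rw [mem_coneDistribution, hk] at hX
      refine eq_zero_of_mfderiv_radialProj_eq_zero hy horth (hα.nondegenerate hX fun w' hw' => ?_)
      obtain ⟨(w : E4), rfl⟩ := surjective_mfderiv_radialProj hy w'
      have hw : w ∈ coneDistribution ξ (t, y) := mem_coneDistribution.2 (by rwa [hk])
      exact (hα.smooth.d_mfderiv isOpen_compl_singleton contMDiffOn_radialProj hy X w).trans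
        (sub_eq_zero.2 (hc w hw))

end Cone

section ConeMap

variable {u : S3 → S3} {ξ : ℝ → Distribution}

/-- The extension of a self-map of `S³` to a self-map of `ℝ⁴` that is homogeneous of degree `1`. -/
noncomputable def coneMap (u : S3 → S3) (y : E4) : E4 := ‖y‖ • (u (radialProj y) : E4)

lemma coneMap_coe (x : S3) : coneMap u (x : E4) = u x := by
  simp [coneMap]

lemma norm_coneMap (y : E4) : ‖coneMap u y‖ = ‖y‖ := by
  simp [coneMap, norm_smul]

lemma radialProj_coneMap {y : E4} (hy : y ≠ 0) : radialProj (coneMap u y) = u (radialProj y) := by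
  rw [coneMap, radialProj_smul (norm_pos_iff.2 hy), radialProj_coe]

lemma contDiffAt_coneMap (hu : ContMDiff (𝓡 3) (𝓡 3) ∞ u) {y : E4} (hy : y ≠ 0) :
    ContDiffAt ℝ ∞ (coneMap u) y := by
  have smooth_comp : ContMDiffAt 𝓘(ℝ, E4) 𝓘(ℝ, E4) ∞ (fun y => (u (radialProj y) : E4)) y :=
    (contMDiff_coe_sphere.comp hu).contMDiffAt.comp y (contMDiffAt_radialProj hy)
  exact (contDiffAt_norm ℝ hy).smul smooth_comp.contDiffAt

lemma isSymmetry_coneMap (hu : ContMDiff (𝓡 3) (𝓡 3) ∞ u)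
    (hξ : ∀ t ∈ Icc (0 : ℝ) 1, ∀ x : S3,
      (ξ t (u x)).comap (mfderiv (𝓡 3) (𝓡 3) u x).toLinearMap = ξ t x) :
    ConicGray.IsSymmetry (coneDistribution ξ) (coneMap u) where
  smooth _ hy := contDiffAt_coneMap hu hy
  norm_eq y _ := norm_coneMap y
  mem_iff t ht y hy w := by
    have hne : coneMap u y ≠ 0 := by
      rw [← norm_ne_zero_iff, norm_coneMap]
      exact norm_ne_zero_iff.2 hy
    have comp_eq : radialProj ∘ coneMap u =ᶠ[𝓝 y] u ∘ radialProj := by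
      filter_upwards [eventually_ne_nhds hy] with z hz using radialProj_coneMap hz
    have pull_coneMap := (ξ t).mem_pull_comp (mdifferentiableAt_radialProj hne)
      ((contDiffAt_coneMap hu hy).differentiableAt (by simp)).mdifferentiableAt w
    have pull_u := (ξ t).mem_pull_comp (hu.mdifferentiableAt (by simp))
      (mdifferentiableAt_radialProj hy) w
    rw [(ξ t).pull_congr comp_eq, mfderiv_eq_fderiv] at pull_coneMap
    rw [mem_coneDistribution, ← hξ t ht (radialProj y)]
    exact pull_u.symm.trans pull_coneMap

end ConeMap

section Restriction

variable {u : S3 → S3} {ξ : ℝ → Distribution}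

lemma restrict_comp_eq_comp_restrict {f : E4 → E4} {hf : ∀ y, ‖f y‖ = ‖y‖}
    (hcomm : ∀ y, ‖y‖ = 1 → f (coneMap u y) = coneMap u (f y)) :
    restrict f hf ∘ u = u ∘ restrict f hf :=
  funext fun x => Subtype.ext <| by
    have := hcomm x (norm_eq_of_mem_sphere x)
    rwa [coneMap_coe, show f x = restrict f hf x from rfl, coneMap_coe] at this

lemma map_mfderiv_restrict {s t : ℝ} {f : E4 → E4} {hf : ∀ y, ‖f y‖ = ‖y‖}
    (hdiffeo : ∃ Φ : E4 ≃ₘ^∞⟮𝓘(ℝ, E4), 𝓘(ℝ, E4)⟯ E4, ⇑Φ = f) {x : S3}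
    (hmem : ∀ v, v ∈ coneDistribution ξ (s, x) ↔ fderiv ℝ f x v ∈ coneDistribution ξ (t, f x)) :
    (ξ s x).map (mfderiv (𝓡 3) (𝓡 3) (restrict f hf) x).toLinearMap = ξ t (restrict f hf x) := by
  have smooth_f : ContDiff ℝ ∞ f := by
    obtain ⟨Φ, rfl⟩ := hdiffeo
    exact Φ.contMDiff.contDiff
  have comap_eq : ξ s x =
      (ξ t (restrict f hf x)).comap (mfderiv (𝓡 3) (𝓡 3) (restrict f hf) x).toLinearMap := by
    ext v
    have chain := mvfderiv_coe_mfderiv_restrict (n := 3) hf smooth_f (by simp) x v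
    rw [← dIncl_mem_coneDistribution, hmem, dIncl, ← chain]
    exact dIncl_mem_coneDistribution (x := restrict f hf x)
      (v := mfderiv (𝓡 3) (𝓡 3) (restrict f hf) x v)
  have surjective : Function.Surjective (mfderiv (𝓡 3) (𝓡 3) (restrict f hf) x) := by
    obtain ⟨φ, hφ⟩ := exists_diffeomorph_eq_restrict (n := 3) hf hdiffeo
    rw [← hφ]
    exact (φ.mfderivToContinuousLinearEquiv (by simp) x).surjective
  rw [comap_eq]
  exact Submodule.map_comap_eq_of_surjective surjective _

end Restriction

end InvContact

open InvContact in
theorem proposition2p2_general (ξ : ℝ → Distribution)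
    (hξ : ∀ t ∈ Icc (0 : ℝ) 1, ∃ α : OneForm, α.IsContact ∧ ξ t = α.kernel)
    (hsmooth : IsSmoothFamily ξ) :
    ∃ ψ : ℝ → S3 → S3,
      (∀ u : S3 → S3, ContMDiff (𝓡 3) (𝓡 3) ∞ u →
        (∀ t ∈ Icc (0 : ℝ) 1, ∀ x : S3,
          (ξ t (u x)).comap (mfderiv (𝓡 3) (𝓡 3) u x).toLinearMap = ξ t x) →
        IsEquivariantIsotopy u ψ) ∧
      ∀ t ∈ Icc (0 : ℝ) 1, ∀ x : S3,
        (ξ 0 x).map (mfderiv (𝓡 3) (𝓡 3) (ψ t) x).toLinearMap = ξ t (ψ t x) := by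
  have := fact_finrank_E4
  have hD := isConicContact_coneDistribution hξ hsmooth
  obtain ⟨Y, hY⟩ := hD.exists_isGrayField
  obtain ⟨Ψ, hΨ, hΨs, hdiffeo⟩ := hY.exists_isEvolution
  have hnorm := hY.norm_eq hΨ
  refine ⟨fun t => UnitSphere.restrict (Ψ t) (hnorm t), fun u hu hξu => ⟨?_, fun t _ => ?_, ?_,
    fun t ht => ?_⟩, fun t ht x => ?_⟩
  · exact ⟨univ, isOpen_univ, subset_univ _,
      (UnitSphere.contMDiff_uncurry_restrict hnorm hΨs).contMDiffOn⟩
  · exact UnitSphere.exists_diffeomorph_eq_restrict (hnorm t) (hdiffeo t)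
  · exact funext fun x => Subtype.ext (hΨ.map_zero x)
  · exact restrict_comp_eq_comp_restrict fun y hy =>
      hY.comm hD hΨ (isSymmetry_coneMap hu hξu) hy ht
  · exact map_mfderiv_restrict (hdiffeo t)
      (hY.mem_iff_fderiv_mem hD hΨ hΨs (norm_eq_of_mem_sphere x) ht)

theorem proposition2p2 (infty : InvContact.S3) (u : InvContact.S3 → InvContact.S3)
    (hu : InvContact.IsAdmissibleInvolution infty u)
    (ξ : ℝ → InvContact.Distribution)
    (hξ : ∀ t ∈ Set.Icc (0 : ℝ) 1, InvContact.IsInvariantContactStructure u (ξ t))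
    (hsmooth : InvContact.IsSmoothFamily ξ) :
    ∃ ψ : ℝ → InvContact.S3 → InvContact.S3,
      InvContact.IsEquivariantIsotopy u ψ ∧
      ∀ t ∈ Set.Icc (0 : ℝ) 1, ∀ x : InvContact.S3,
        (ξ 0 x).map (mfderiv (𝓡 3) (𝓡 3) (ψ t) x).toLinearMap = ξ t (ψ t x) := by
  obtain ⟨ψ, hψ, hmap⟩ := proposition2p2_general ξ
    (fun t ht => (hξ t ht).imp fun _ h => ⟨h.1, h.2.1⟩) hsmooth
  exact ⟨ψ, hψ u hu.smooth fun t ht => (hξ t ht).choose_spec.2.2.1, hmap⟩
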